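/- Setting. Fix pairwise disjoint infinite sets of constants, labeled nulls and variables, and a finite relational schema (relation symbols with arities). A database instance $I$ is a finite set of atoms over constants and nulls; $\mathrm{dom}(I)$ is the set of constants and nulls occurring in it. A constraint is either a TGD $\forall\bar x\,(\phi(\bar x)\to\exists\bar y\,\psi(\bar x,\bar y))$, with $\phi,\psi$ conjunctions of relational atoms over variables and constants, $\psi$ non-empty, $\phi$ possibly empty, and every variable of $\bar x$ in $\psi$ occurring in $\phi$, or an EGD $\forall\bar x\,(\phi(\bar x)\to x_i=x_j)$ with $\phi$ non-empty and $x_i,x_j$ occurring in $\phi$. For a tuple $\bar a$ of constants and nulls, $\alpha(\bar a)$ is $\alpha$ with its universally quantified variables instantiated by $\bar a$. Chase steps. For a TGD $\alpha$, the oblivious step $I\xrightarrow{*,\alpha,\bar a}J$ exists whenever $\phi(\bar a)\subseteq I$; then $J=I\cup\psi(\bar a,\bar n)$, where $\bar n$ are distinct nulls not in $\mathrm{dom}(I)$. The (standard) chase step $I\xrightarrow{\alpha,\bar a}J$ is the same, but requires in addition $I\not\models\alpha(\bar a)$. For an EGD both kinds of step coincide: they require $I\not\models\alpha(\bar a)$,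 that is, $\phi(\bar a)\subseteq I$ and $a_i\ne a_j$, and $J$ is $I$ with one of $a_i,a_j$ that is a null replaced everywhere by the other; if both are constants, there is no step (the chase fails). A chase sequence of $I$ with a set $\Sigma$ of constraints is a finite or infinite sequence $I=I_0\to I_1\to\cdots$ of standard chase steps with constraints from $\Sigma$, in any order; its length is its number of steps. (Exhaustiveness is not required.) Weak acyclicity. The dependency graph of a set of constraints has the positions $(R,i)$ as vertices. For every TGD in the set, every universally quantified variable $x$ occurring in $\psi$, and every occurrence of $x$ in $\phi$ at a position $\pi_1$, there is an edge $\pi_1\to\pi_2$ for each position $\pi_2$ of $x$ in $\psi$, and a special edge $\pi_1\xrightarrow{*}\pi_2$ for each position $\pi_2$ in $\psi$ of an existentially quantified variable. The set is weakly acyclic iff this graph has no cycle through a special edge. c-stratification. For constraints $\alpha,\beta$ write $\alpha\prec_c\beta$ iff there are a database instance $I$, tuples $\bar a,\bar b$ of constants and nulls, and $J$ such that $I\models\beta(\bar b)$, $I\xrightarrow{*,\alpha,\bar a}J$ and $J\not\models\beta(\bar b)$. The c-chase graph $G_c(\Sigma)$ has vertex set $\Sigma$ and an edge $(\alpha,\beta)$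 iff $\alpha\prec_c\beta$. $\Sigma$ is c-stratified iff for every cycle of $G_c(\Sigma)$ (closed walk of length at least 1, vertices may repeat) the set of constraints on it is weakly acyclic. Theorem. Let $\Sigma$ be a finite c-stratified set of TGDs and EGDs. Then there is a polynomial $Q\in\mathbb N[X]$ such that for every database instance $I$, every chase sequence of $I$ with $\Sigma$ is finite and has length at most $Q(|\mathrm{dom}(I)|)$. -/

import Mathlib

namespace Chase

/-- Elements that may occur in database instances: constants and labeled nulls. -/
inductive Val (C N : Type*) where
  | const (c : C) : Val C N
  | null (n : N) : Val C N

/-- Terms that may occur in constraints: constants (parameters) and variables. -/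
inductive Term (C V : Type*) where
  | const (c : C) : Term C V
  | var (x : V) : Term C V

/-- Relational atoms over a schema with relation symbols `R` of arities `ar`,
with arguments from `T`. -/
structure Atom {R : Type*} (ar : R → ℕ) (T : Type*) where
  rel : R
  args : Fin (ar rel) → T

/-- Positions `(R, i)` of the schema. -/
abbrev Position {R : Type*} (ar : R → ℕ) := (r : R) × Fin (ar r)

variable {R : Type*} {ar : R → ℕ} {C N V : Type*}

/-- Apply a function to all arguments of an atom. -/
def Atom.map {T T' : Type*} (f : T → T') (A : Atom ar T) : Atom ar T' :=
  ⟨A.rel, fun i => f (A.args i)⟩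

/-- `t` occurs in position `π` in the set of atoms `X`. -/
def OccursAt {T : Type*} (X : Set (Atom ar T)) (t : T) (π : Position ar) : Prop :=
  ∃ A ∈ X, ∃ i : Fin (ar A.rel), (⟨A.rel, i⟩ : Position ar) = π ∧ A.args i = t

/-- The domain of a set of atoms over constants and nulls: all elements occurring in it. -/
def dom {T : Type*} (X : Set (Atom ar T)) : Set T :=
  {t | ∃ A ∈ X, ∃ i, A.args i = t}

/-- The variables occurring in a set of atoms. -/
def vars (X : Set (Atom ar (Term C V))) : Set V := {x | Term.var x ∈ dom X}

/-- Constraints: a TGD `∀ x̄ (⋀ body → ∃ ȳ ⋀ head)`, where the universally quantified variables are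
those of the body and the existentially quantified ones are those that occur in the head only,
or an EGD `∀ x̄ (⋀ body → x = y)`. -/
inductive Constraint {R : Type*} (ar : R → ℕ) (C V : Type*) where
  | tgd (body head : Finset (Atom ar (Term C V))) (head_nonempty : head.Nonempty) :
      Constraint ar C V
  | egd (body : Finset (Atom ar (Term C V))) (x y : V) (body_nonempty : body.Nonempty)
      (hx : x ∈ vars (body : Set (Atom ar (Term C V))))
      (hy : y ∈ vars (body : Set (Atom ar (Term C V)))) :
      Constraint ar C V

/-- The value of a term under an assignment of the variables (constants are fixed). -/
def Term.eval (σ : V → Val C N) : Term C V → Val C N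
  | .const c => .const c
  | .var x => σ x

/-- The image of a set of atoms under an assignment. -/
def image (σ : V → Val C N) (X : Set (Atom ar (Term C V))) : Set (Atom ar (Val C N)) :=
  Atom.map (Term.eval σ) '' X

/-- `I ⊨ α(σ)`. Only the values of `σ` on the universally quantified variables matter, so `σ`
stands for the tuple of parameters. -/
def Satisfies (I : Set (Atom ar (Val C N))) : Constraint ar C V → (V → Val C N) → Prop
  | .tgd body head _, σ =>
      image σ body ⊆ I →
        ∃ τ : V → Val C N, Set.EqOn τ σ (vars (body : Set (Atom ar (Term C V)))) ∧
          image τ head ⊆ I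
  | .egd body x y _ _ _, σ => image σ body ⊆ I → σ x = σ y

/-- Replace the element `u` by `v`. -/
noncomputable def replace (u v : Val C N) (w : Val C N) : Val C N :=
  open Classical in if w = u then v else w

/-- `J` arises from `I` by adding the head of a TGD under `σ`, where the existentially quantified
variables are mapped to distinct fresh nulls. -/
def AddsHead (body head : Set (Atom ar (Term C V))) (σ : V → Val C N)
    (I J : Set (Atom ar (Val C N))) : Prop :=
  ∃ ν : V → Val C N, Set.EqOn ν σ (vars body) ∧
    (∀ y ∈ vars head \ vars body, ∃ n : N, ν y = .null n ∧ Val.null n ∉ dom I) ∧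
    Set.InjOn ν (vars head \ vars body) ∧
    J = I ∪ image ν head

/-- `J` arises from `I` by equating `a` and `b`, replacing one of them, which has to be a null,
by the other one everywhere. -/
def Equates (a b : Val C N) (I J : Set (Atom ar (Val C N))) : Prop :=
  ((∃ n : N, b = .null n) ∧ J = Atom.map (replace b a) '' I) ∨
  ((∃ n : N, a = .null n) ∧ J = Atom.map (replace a b) '' I)

/-- The (standard) chase step from `I` to `J` with `α(σ)`. There is none if an EGD would have
to equate two distinct constants. -/
def Step : Constraint ar C V → (V → Val C N) →
    Set (Atom ar (Val C N)) → Set (Atom ar (Val C N)) → Prop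
  | .tgd body head _, σ, I, J =>
      image σ body ⊆ I ∧
      (¬ ∃ τ : V → Val C N, Set.EqOn τ σ (vars (body : Set (Atom ar (Term C V)))) ∧
          image τ head ⊆ I) ∧
      AddsHead body head σ I J
  | .egd body x y _ _ _, σ, I, J => image σ body ⊆ I ∧ σ x ≠ σ y ∧ Equates (σ x) (σ y) I J

/-- The oblivious chase step from `I` to `J` with `α(σ)`: a TGD may be applied although it is
satisfied; for EGDs it is the chase step. -/
def ObliviousStep : Constraint ar C V → (V → Val C N) →
    Set (Atom ar (Val C N)) → Set (Atom ar (Val C N)) → Prop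
  | .tgd body head _, σ, I, J => image σ body ⊆ I ∧ AddsHead body head σ I J
  | .egd body x y _ _ _, σ, I, J => image σ body ⊆ I ∧ σ x ≠ σ y ∧ Equates (σ x) (σ y) I J

/-- `s 0 = I, s 1, s 2, …` is a sequence of `len ≤ ∞` chase steps with constraints from `S`.
It is not required to be exhaustive, so prefixes of chase sequences and failing ones are covered. -/
def IsChaseSequence (S : Set (Constraint ar C V)) (I : Set (Atom ar (Val C N)))
    (len : ℕ∞) (s : ℕ → Set (Atom ar (Val C N))) : Prop :=
  s 0 = I ∧ ∀ i : ℕ, (i : ℕ∞) < len → ∃ α ∈ S, ∃ σ : V → Val C N, Step α σ (s i) (s (i + 1))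

/-- Ordinary edges of the dependency graph. -/
def NormalEdge (S : Set (Constraint ar C V)) (π₁ π₂ : Position ar) : Prop :=
  ∃ body head h, Constraint.tgd body head h ∈ S ∧ ∃ x : V,
    OccursAt (body : Set (Atom ar (Term C V))) (.var x) π₁ ∧
    OccursAt (head : Set (Atom ar (Term C V))) (.var x) π₂

/-- Special edges of the dependency graph. -/
def SpecialEdge (S : Set (Constraint ar C V)) (π₁ π₂ : Position ar) : Prop :=
  ∃ body head h, Constraint.tgd body head h ∈ S ∧ ∃ x y : V,
    OccursAt (body : Set (Atom ar (Term C V))) (.var x) π₁ ∧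
    x ∈ vars (head : Set (Atom ar (Term C V))) ∧
    y ∉ vars (body : Set (Atom ar (Term C V))) ∧
    OccursAt (head : Set (Atom ar (Term C V))) (.var y) π₂

/-- The dependency graph has no cycle through a special edge. -/
def WeaklyAcyclic (S : Set (Constraint ar C V)) : Prop :=
  ¬ ∃ π₁ π₂ : Position ar, SpecialEdge S π₁ π₂ ∧
    Relation.ReflTransGen (fun p q => NormalEdge S p q ∨ SpecialEdge S p q) π₂ π₁

/-- `α ≺_c β`: some oblivious step with `α` on a (finite) database instance over the constants `C`
and the nulls `N` turns `β(τ)` from satisfied to violated. -/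
def PrecC (N : Type*) (α β : Constraint ar C V) : Prop :=
  ∃ (I J : Set (Atom ar (Val C N))) (σ τ : V → Val C N), I.Finite ∧
    Satisfies I β τ ∧ ObliviousStep α σ I J ∧ ¬ Satisfies J β τ

/-- `c 0 → c 1 → ⋯ → c k → c 0` is a cycle (closed walk) of the c-chase graph of `S`;
the index addition in `Fin (k + 1)` wraps around. -/
def IsCycle (N : Type*) (S : Set (Constraint ar C V)) {k : ℕ}
    (c : Fin (k + 1) → Constraint ar C V) : Prop :=
  ∀ i, c i ∈ S ∧ PrecC N (c i) (c (i + 1))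

/-- The constraints in every cycle of the c-chase graph are weakly acyclic. -/
def CStratified (N : Type*) (S : Set (Constraint ar C V)) : Prop :=
  ∀ (k : ℕ) (c : Fin (k + 1) → Constraint ar C V), IsCycle N S c → WeaklyAcyclic (Set.range c)

end Chase

namespace Chase

variable {R : Type*} {ar : R → ℕ} {C N V : Type*}

/-! Induct on the number of constraints. Choose a strongly connected component of the c-chase graph
without outgoing edges, and let D be the set of remaining constraints. No constraint γ of the
component precedes a constraint δ of D, so a trigger of δ that is violated after an oblivious γ-step
was already violated before it, and the δ-step can be moved in front (`exists_commute`). The γ-step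
stays possible, but perhaps only as an oblivious step, since the earlier δ-step may have satisfied
it; this is why ≺_c is defined with oblivious steps. Doing this throughout (`exists_subchase`) shows
that the D-steps of any chase form a chase with D alone, so by induction their number is at most
some q polynomial in the size of the initial domain. Moving steps requires that vanished nulls never
return, which renaming achieves (`exists_noReuse`).

It remains to bound the steps of the component in terms of q.

If the component contains a cycle, one closed walk visits all of it, so it is weakly acyclic and its
positions can be ranked. Since EGDs rename values, values are tracked by tokens: pairs of a birth
time and a value, followed through later renamings. Two steps with the same TGD and the same tokens
on the frontier (the universal variables of the head) cannot both occur: the head added first,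
carried along by the renamings, witnesses the second. So a token bound for ranks below p bounds the
TGD steps with frontier below p, and thereby the tokens for rank p. As the number of ranks is fixed,
the result is polynomial. EGD steps are paid for by the domain, which each of them shrinks
(`length_le_of_rank`).

Otherwise the component is a single β with β ⊀_c β. Its triggers are already violated in the chase
with D alone, so their values come from a domain of polynomial size; between two consecutive D-steps
no trigger repeats, because β-steps cannot violate a satisfied instance of β
(`stepCount_singleton_le`). -/

/-- The body of a constraint. -/
def Constraint.body : Constraint ar C V → Finset (Atom ar (Term C V))
  | .tgd body _ _ => body
  | .egd body _ _ _ _ _ => body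

/-- The head of a TGD; empty for an EGD. -/
def Constraint.head : Constraint ar C V → Finset (Atom ar (Term C V))
  | .tgd _ head _ => head
  | .egd _ _ _ _ _ _ => ∅

/-! ### Domains, variables and images under assignments -/

section Basic

theorem dom_mono {T : Type*} {X Y : Set (Atom ar T)} (h : X ⊆ Y) : dom X ⊆ dom Y := by
  rintro t ⟨A, hA, i, hi⟩
  exact ⟨A, h hA, i, hi⟩

theorem dom_union {T : Type*} (X Y : Set (Atom ar T)) : dom (X ∪ Y) = dom X ∪ dom Y := by
  ext t
  constructor
  · rintro ⟨A, hA | hA, i, hi⟩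
    · exact Or.inl ⟨A, hA, i, hi⟩
    · exact Or.inr ⟨A, hA, i, hi⟩
  · rintro (⟨A, hA, i, hi⟩ | ⟨A, hA, i, hi⟩)
    · exact ⟨A, Or.inl hA, i, hi⟩
    · exact ⟨A, Or.inr hA, i, hi⟩

theorem dom_map_image {T T' : Type*} (f : T → T') (X : Set (Atom ar T)) :
    dom (Atom.map f '' X) = f '' dom X := by
  ext t
  constructor
  · rintro ⟨_, ⟨A, hA, rfl⟩, i, rfl⟩
    exact ⟨A.args i, ⟨A, hA, i, rfl⟩, rfl⟩
  · rintro ⟨_, ⟨A, hA, i, rfl⟩, rfl⟩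
    exact ⟨_, ⟨A, hA, rfl⟩, i, rfl⟩

theorem dom_image (σ : V → Val C N) (X : Set (Atom ar (Term C V))) :
    dom (image σ X) = Term.eval σ '' dom X :=
  dom_map_image _ _

theorem finite_dom {T : Type*} {X : Set (Atom ar T)} (h : X.Finite) : (dom X).Finite := by
  have : dom X = ⋃ A ∈ X, Set.range A.args := by
    ext t
    simp [dom]
  rw [this]
  exact h.biUnion fun A _ => Set.finite_range _

theorem finite_vars {X : Set (Atom ar (Term C V))} (h : X.Finite) : (vars X).Finite :=
  (finite_dom h).preimage (f := Term.var) fun _ _ _ _ h => by simpa using h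

theorem finite_consts {X : Set (Atom ar (Term C V))} (h : X.Finite) :
    {c : C | Term.const c ∈ dom X}.Finite :=
  (finite_dom h).preimage (f := Term.const) fun _ _ _ _ h => by simpa using h

theorem apply_mem_dom_image {X : Set (Atom ar (Term C V))} {x : V} (hx : x ∈ vars X)
    (σ : V → Val C N) : σ x ∈ dom (image σ X) := by
  rw [dom_image]
  exact ⟨_, hx, rfl⟩

theorem mem_dom_image {X : Set (Atom ar (Term C V))} {σ : V → Val C N} {v : Val C N}
    (h : v ∈ dom (image σ X)) :
    (∃ x ∈ vars X, σ x = v) ∨ ∃ c, Term.const c ∈ dom X ∧ v = .const c := by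
  rw [dom_image] at h
  obtain ⟨c | x, ht, rfl⟩ := h
  · exact Or.inr ⟨c, ht, rfl⟩
  · exact Or.inl ⟨x, ht, rfl⟩

theorem map_congr {T T' : Type*} {f g : T → T'} {X : Set (Atom ar T)} (h : Set.EqOn f g (dom X)) :
    Atom.map f '' X = Atom.map g '' X := by
  apply Set.image_congr
  intro A hA
  simp only [Atom.map, Atom.mk.injEq, heq_eq_eq, true_and]
  funext i
  exact h ⟨A, hA, i, rfl⟩

theorem map_id_image {T : Type*} (X : Set (Atom ar T)) : Atom.map id '' X = X :=
  Set.image_id X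

theorem map_map_image {T T' T'' : Type*} (f : T → T') (g : T' → T'') (X : Set (Atom ar T)) :
    Atom.map g '' (Atom.map f '' X) = Atom.map (g ∘ f) '' X := by
  rw [Set.image_image]
  rfl

theorem image_congr {σ τ : V → Val C N} {X : Set (Atom ar (Term C V))}
    (h : Set.EqOn σ τ (vars X)) : image σ X = image τ X := by
  apply map_congr
  rintro (c | x) ht
  · rfl
  · exact h ht

theorem map_image {f : Val C N → Val C N} (hf : ∀ c, f (.const c) = .const c) (σ : V → Val C N)
    (X : Set (Atom ar (Term C V))) : Atom.map f '' image σ X = image (f ∘ σ) X := by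
  rw [image, map_map_image]
  apply map_congr
  rintro (c | x) ht
  · exact hf c
  · rfl

theorem image_finite (σ : V → Val C N) {X : Set (Atom ar (Term C V))} (h : X.Finite) :
    (image σ X).Finite := h.image _

theorem replace_self (u v : Val C N) : replace u v u = v := by simp [replace]

theorem replace_of_ne {u v w : Val C N} (h : w ≠ u) : replace u v w = w := by simp [replace, h]

theorem replace_const (n : N) (v : Val C N) (c : C) :
    replace (.null n) v (.const c) = .const c := replace_of_ne (by simp)

theorem replace_ne {u v : Val C N} (h : v ≠ u) (w : Val C N) : replace u v w ≠ u := by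
  by_cases hw : w = u
  · rw [hw, replace_self]; exact h
  · rwa [replace_of_ne hw]

theorem equates_iff {a b : Val C N} {I J : Set (Atom ar (Val C N))} :
    Equates a b I J ↔ ∃ n v, ((a = .null n ∧ b = v) ∨ (b = .null n ∧ a = v)) ∧
      J = Atom.map (replace (.null n) v) '' I := by
  constructor
  · rintro (⟨⟨n, rfl⟩, rfl⟩ | ⟨⟨n, rfl⟩, rfl⟩)
    · exact ⟨n, a, Or.inr ⟨rfl, rfl⟩, rfl⟩
    · exact ⟨n, b, Or.inl ⟨rfl, rfl⟩, rfl⟩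
  · rintro ⟨n, v, ⟨rfl, rfl⟩ | ⟨rfl, rfl⟩, rfl⟩
    · exact Or.inr ⟨⟨n, rfl⟩, rfl⟩
    · exact Or.inl ⟨⟨n, rfl⟩, rfl⟩

end Basic

/-! ### Chase steps: common form, renaming and commutation -/

section Steps

theorem Satisfies.congr {I : Set (Atom ar (Val C N))} {α : Constraint ar C V} {σ τ : V → Val C N}
    (h : Set.EqOn σ τ (vars (α.body : Set (Atom ar (Term C V))))) (hs : Satisfies I α σ) :
    Satisfies I α τ := by
  cases α with
  | tgd body head hh =>
    intro hb
    simp only [Constraint.body] at h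
    obtain ⟨υ, hυ, hI⟩ := hs (by rwa [image_congr h])
    exact ⟨υ, hυ.trans h, hI⟩
  | egd body x y hne hx hy =>
    intro hb
    simp only [Constraint.body] at h
    rw [← h hx, ← h hy]
    exact hs (by rwa [image_congr h])

theorem not_satisfies_of_step {α : Constraint ar C V} {σ : V → Val C N}
    {I J : Set (Atom ar (Val C N))} (h : Step α σ I J) : ¬ Satisfies I α σ := by
  cases α with
  | tgd body head hh => exact fun hs => h.2.1 (hs h.1)
  | egd body x y hne hx hy => exact fun hs => h.2.1 (hs h.1)

theorem body_subset_of_not_satisfies {α : Constraint ar C V} {σ : V → Val C N}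
    {I : Set (Atom ar (Val C N))} (h : ¬ Satisfies I α σ) :
    image σ (α.body : Set (Atom ar (Term C V))) ⊆ I := by
  cases α with
  | tgd body head hh => by_contra hb; exact h fun hb' => (hb hb').elim
  | egd body x y hne hx hy => by_contra hb; exact h fun hb' => (hb hb').elim

theorem obliviousStep_of_step {α : Constraint ar C V} {σ : V → Val C N}
    {I J : Set (Atom ar (Val C N))} (h : Step α σ I J) : ObliviousStep α σ I J := by
  cases α with
  | tgd body head hh => exact ⟨h.1, h.2.2⟩
  | egd body x y hne hx hy => exact h

/-- For an EGD this holds vacuously: the replaced null is gone from `J`, while the body under `σ`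
contains it. -/
theorem satisfies_of_step {α : Constraint ar C V} {σ : V → Val C N}
    {I J : Set (Atom ar (Val C N))} (h : Step α σ I J) : Satisfies J α σ := by
  cases α with
  | tgd body head hh =>
    obtain ⟨-, -, ν, hν, -, -, rfl⟩ := h
    exact fun _ => ⟨ν, hν, Set.subset_union_right⟩
  | egd body x y hne hx hy =>
    obtain ⟨-, hxy, he⟩ := h
    obtain ⟨n, v, hnv, rfl⟩ := equates_iff.1 he
    intro hb
    exfalso
    have hv : v ≠ .null n := by
      rcases hnv with ⟨h1, h2⟩ | ⟨h1, h2⟩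
      · rw [← h1, ← h2]; exact hxy.symm
      · rw [← h1, ← h2]; exact hxy
    have hn : Val.null n ∈ dom (Atom.map (replace (.null n) v) '' I) := by
      apply dom_mono hb
      rcases hnv with ⟨h1, -⟩ | ⟨h1, -⟩
      · rw [← h1]; exact apply_mem_dom_image hx σ
      · rw [← h1]; exact apply_mem_dom_image hy σ
    rw [dom_map_image] at hn
    obtain ⟨w, -, hw⟩ := hn
    exact replace_ne hv w hw

/-- The effect of a chase step in a form common to TGDs and EGDs: the elements of `I` are renamed
by `ρ`, and the head is added under `ν`. -/
structure StepData (α : Constraint ar C V) (σ : V → Val C N) (I J : Set (Atom ar (Val C N)))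
    (ρ : Val C N → Val C N) (ν : V → Val C N) : Prop where
  map_const : ∀ c, ρ (.const c) = .const c
  body_subset : image σ (α.body : Set (Atom ar (Term C V))) ⊆ I
  eqOn : Set.EqOn ν σ (vars (α.body : Set (Atom ar (Term C V))))
  eq_union : J = Atom.map ρ '' I ∪ image ν (α.head : Set (Atom ar (Term C V)))
  eq_id : α.head.Nonempty → ρ = id
  not_head : α.head.Nonempty →
    ¬ ∃ τ : V → Val C N, Set.EqOn τ σ (vars (α.body : Set (Atom ar (Term C V)))) ∧
      image τ (α.head : Set (Atom ar (Term C V))) ⊆ I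
  collapse : ¬ α.head.Nonempty → ∃ a ∈ dom I, ∃ b ∈ dom I, a ≠ b ∧ ρ a = ρ b
  map_dom : ∀ v ∈ dom I, ρ v ∈ dom I

theorem exists_stepData {α : Constraint ar C V} {σ : V → Val C N}
    {I J : Set (Atom ar (Val C N))} (h : Step α σ I J) : ∃ ρ ν, StepData α σ I J ρ ν := by
  cases α with
  | tgd body head hh =>
    obtain ⟨hb, hn, ν, hν, -, -, rfl⟩ := h
    exact ⟨id, ν, fun _ => rfl, hb, hν, by rw [map_id_image]; rfl, fun _ => rfl, fun _ => hn,
      fun h => (h hh).elim, fun _ hv => hv⟩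
  | egd body x y hne hx hy =>
    obtain ⟨hb, hxy, he⟩ := h
    obtain ⟨n, v, hnv, rfl⟩ := equates_iff.1 he
    have h1 := dom_mono hb (apply_mem_dom_image hx σ)
    have h2 := dom_mono hb (apply_mem_dom_image hy σ)
    refine ⟨_, σ, replace_const n v, hb, fun _ _ => rfl, by simp [Constraint.head, image],
      fun h => by simp [Constraint.head] at h, fun h => by simp [Constraint.head] at h,
      fun _ => ⟨_, h1, _, h2, hxy, ?_⟩, fun w hw => ?_⟩
    · rcases hnv with ⟨h, h'⟩ | ⟨h, h'⟩
      · rw [h, replace_self, h', replace_of_ne (by rw [← h, ← h']; exact hxy.symm)]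
      · rw [h, replace_self, h', replace_of_ne (by rw [← h, ← h']; exact hxy)]
    · by_cases h : w = .null n
      · rw [h, replace_self]
        rcases hnv with ⟨-, h'⟩ | ⟨-, h'⟩
        · exact h' ▸ h2
        · exact h' ▸ h1
      · rwa [replace_of_ne h]

theorem StepData.finite {α : Constraint ar C V} {σ : V → Val C N} {I J : Set (Atom ar (Val C N))}
    {ρ : Val C N → Val C N} {ν : V → Val C N} (h : StepData α σ I J ρ ν) (hI : I.Finite) :
    J.Finite := by
  rw [h.eq_union]
  exact (hI.image _).union (image_finite _ (Finset.finite_toSet _))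

theorem finite_of_step {α : Constraint ar C V} {σ : V → Val C N} {I J : Set (Atom ar (Val C N))}
    (h : Step α σ I J) (hI : I.Finite) : J.Finite := by
  obtain ⟨ρ, ν, hd⟩ := exists_stepData h
  exact hd.finite hI

/-- Chase steps are invariant under renaming of nulls. -/
theorem Step.map {α : Constraint ar C V} {σ : V → Val C N} {I J : Set (Atom ar (Val C N))}
    (h : Step α σ I J) (e : Val C N ≃ Val C N) (he : ∀ c, e (.const c) = .const c) :
    Step α (e ∘ σ) (Atom.map e '' I) (Atom.map e '' J) := by
  have hnull : ∀ n, ∃ n', e (.null n) = .null n' := by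
    intro n
    rcases hn : e (.null n) with c | n'
    · rw [← he c] at hn
      exact absurd (e.injective hn) (by simp)
    · exact ⟨n', rfl⟩
  have he' : ∀ c, e.symm (.const c) = .const c := fun c => by rw [e.symm_apply_eq, he]
  have hmem : ∀ v, e v ∈ dom (Atom.map e '' I) ↔ v ∈ dom I := by
    intro v
    rw [dom_map_image]
    exact e.injective.mem_set_image
  cases α with
  | tgd body head hh =>
    obtain ⟨hb, hn, ν, hν, hf, hinj, rfl⟩ := h
    refine ⟨?_, ?_, e ∘ ν, ?_, ?_, ?_, ?_⟩
    · rw [← map_image he]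
      exact Set.image_mono hb
    · rintro ⟨τ, hτ, hI⟩
      refine hn ⟨e.symm ∘ τ, fun x hx => ?_, ?_⟩
      · simp [hτ hx]
      · rw [← map_image he']
        refine (Set.image_mono hI).trans ?_
        rw [map_map_image]
        simp [map_id_image]
    · exact fun x hx => congrArg e (hν hx)
    · intro y hy
      obtain ⟨n, hn1, hn2⟩ := hf y hy
      obtain ⟨n', hn'⟩ := hnull n
      refine ⟨n', by simp [hn1, hn'], ?_⟩
      rwa [← hn', hmem]
    · exact e.injective.comp_injOn hinj
    · rw [Set.image_union, map_image he]
  | egd body x y hne hx hy =>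
    obtain ⟨hb, hxy, h⟩ := h
    refine ⟨?_, e.injective.ne hxy, ?_⟩
    · rw [← map_image he]
      exact Set.image_mono hb
    · obtain ⟨n, v, hnv, rfl⟩ := equates_iff.1 h
      obtain ⟨n', hn'⟩ := hnull n
      refine equates_iff.2 ⟨n', e v, ?_, ?_⟩
      · rcases hnv with ⟨h1, h2⟩ | ⟨h1, h2⟩
        · left; simp [h1, h2, hn']
        · right; simp [h1, h2, hn']
      · rw [map_map_image, map_map_image]
        apply map_congr
        intro w _
        by_cases hw : w = .null n
        · simp [hw, replace_self, hn']
        · have : e w ≠ .null n' := by rw [← hn']; exact e.injective.ne hw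
          simp [replace_of_ne hw, replace_of_ne this]

/-- A chase step with `α` can be moved in front of an oblivious step with `γ`, provided that `α`
was violated before and that no null is reused. -/
theorem exists_commute {γ α : Constraint ar C V} {τ σ : V → Val C N}
    {K J J' : Set (Atom ar (Val C N))} (hγ : ObliviousStep γ τ K J) (hα : Step α σ J J')
    (hK : ¬ Satisfies K α σ)
    (hfresh : ∀ n : N, Val.null n ∈ dom J' → Val.null n ∈ dom K → Val.null n ∈ dom J) :
    ∃ K' τ', Step α σ K K' ∧ ObliviousStep γ τ' K' J' ∧ dom K' ⊆ dom K ∪ dom J' ∧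
      ∀ n : N, Val.null n ∈ dom K' → Val.null n ∉ dom K →
        Val.null n ∉ dom J ∧ Val.null n ∈ dom J' := by
  have hbK := body_subset_of_not_satisfies hK
  cases α with
  | tgd body head hh =>
    obtain ⟨hb, hn, ν, hν, hf, hinj, rfl⟩ := hα
    have hνJ' : ∀ y ∈ vars (head : Set (Atom ar (Term C V))),
        ν y ∈ dom (J ∪ image ν (head : Set (Atom ar (Term C V)))) :=
      fun y hy => dom_mono Set.subset_union_right (apply_mem_dom_image hy ν)
    have hfK : ∀ y ∈ vars (head : Set (Atom ar (Term C V))) \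
        vars (body : Set (Atom ar (Term C V))),
        ∃ n : N, ν y = .null n ∧ Val.null n ∉ dom K := by
      intro y hy
      obtain ⟨n, h1, h2⟩ := hf y hy
      exact ⟨n, h1, fun h => h2 (hfresh n (h1 ▸ hνJ' y hy.1) h)⟩
    -- Every null of the added head lies in both `dom K` and `dom J` or in neither, whereas a null
    -- that γ creates or eliminates lies in exactly one of them. Hence the two steps do not
    -- interfere.
    have hval : ∀ v ∈ dom (image ν (head : Set (Atom ar (Term C V)))),
        (∃ c, v = .const c) ∨ (v ∈ dom K ∧ v ∈ dom J) ∨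
          ∃ n, v = .null n ∧ Val.null n ∉ dom K ∧ Val.null n ∉ dom J := by
      intro v hv
      rcases mem_dom_image hv with ⟨x, hx, rfl⟩ | ⟨c, -, rfl⟩
      · by_cases hxb : x ∈ vars (body : Set (Atom ar (Term C V)))
        · right; left
          rw [hν hxb]
          exact ⟨dom_mono hbK (apply_mem_dom_image hxb σ),
            dom_mono hb (apply_mem_dom_image hxb σ)⟩
        · right; right
          obtain ⟨n, h1, h2⟩ := hf x ⟨hx, hxb⟩
          exact ⟨n, h1, fun h => h2 (hfresh n (h1 ▸ hνJ' x hx) h), h2⟩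
      · exact Or.inl ⟨c, rfl⟩
    refine ⟨K ∪ image ν (head : Set (Atom ar (Term C V))), τ,
      ⟨hbK, fun h => hK fun _ => h, ν, hν, hfK, hinj, rfl⟩, ?_, ?_, ?_⟩
    · cases γ with
      | tgd body₂ head₂ hh₂ =>
        obtain ⟨hb₂, ν₂, hν₂, hf₂, hinj₂, rfl⟩ := hγ
        refine ⟨hb₂.trans Set.subset_union_left, ν₂, hν₂, fun y hy => ?_, hinj₂,
          Set.union_right_comm _ _ _⟩
        obtain ⟨n, h1, h2⟩ := hf₂ y hy
        refine ⟨n, h1, ?_⟩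
        rw [dom_union]
        rintro (h | h)
        · exact h2 h
        · rcases hval _ h with ⟨c, hc⟩ | ⟨h', -⟩ | ⟨n', hn', -, h'⟩
          · simp at hc
          · exact h2 h'
          · apply h'
            rw [← hn', ← h1]
            exact dom_mono Set.subset_union_right (apply_mem_dom_image hy.1 ν₂)
      | egd body₂ x y hne hx hy =>
        obtain ⟨hb₂, hxy, he⟩ := hγ
        refine ⟨hb₂.trans Set.subset_union_left, hxy, ?_⟩
        obtain ⟨m, w, hmw, rfl⟩ := equates_iff.1 he
        refine equates_iff.2 ⟨m, w, hmw, ?_⟩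
        rw [Set.image_union]
        congr 1
        have hw : w ≠ .null m := by
          rcases hmw with ⟨h1, h2⟩ | ⟨h1, h2⟩
          · rw [← h1, ← h2]; exact hxy.symm
          · rw [← h1, ← h2]; exact hxy
        have hm : Val.null m ∈ dom K := by
          apply dom_mono hb₂
          rcases hmw with ⟨h1, -⟩ | ⟨h1, -⟩
          · rw [← h1]; exact apply_mem_dom_image hx τ
          · rw [← h1]; exact apply_mem_dom_image hy τ
        conv_lhs => rw [← map_id_image (image ν (head : Set (Atom ar (Term C V))))]
        apply map_congr
        intro v hv
        symm
        apply replace_of_ne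
        rintro rfl
        rcases hval _ hv with ⟨c, hc⟩ | ⟨-, h'⟩ | ⟨n', hn', h', -⟩
        · simp at hc
        · rw [dom_map_image] at h'
          obtain ⟨u, -, hu⟩ := h'
          exact replace_ne hw u hu
        · exact h' (hn' ▸ hm)
    · rw [dom_union, dom_union]
      exact Set.union_subset_union_right _ Set.subset_union_right
    · intro n h1 h2
      rw [dom_union] at h1
      have h3 := h1.resolve_left h2
      refine ⟨?_, dom_mono Set.subset_union_right h3⟩
      rcases hval _ h3 with ⟨c, hc⟩ | ⟨h', -⟩ | ⟨n', hn', -, h'⟩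
      · simp at hc
      · exact (h2 h').elim
      · rwa [hn']
  | egd body x y hne hx hy =>
    obtain ⟨hb, hxy, he⟩ := hα
    obtain ⟨n, v, hnv, rfl⟩ := equates_iff.1 he
    have hv : v ≠ .null n := by
      rcases hnv with ⟨h1, h2⟩ | ⟨h1, h2⟩
      · rw [← h1, ← h2]; exact hxy.symm
      · rw [← h1, ← h2]; exact hxy
    have hmem : ∀ L : Set (Atom ar (Val C N)), image σ (body : Set (Atom ar (Term C V))) ⊆ L →
        Val.null n ∈ dom L ∧ v ∈ dom L := by
      intro L hL
      have h1 := dom_mono hL (apply_mem_dom_image hx σ)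
      have h2 := dom_mono hL (apply_mem_dom_image hy σ)
      rcases hnv with ⟨h3, h4⟩ | ⟨h3, h4⟩
      · exact ⟨h3 ▸ h1, h4 ▸ h2⟩
      · exact ⟨h3 ▸ h2, h4 ▸ h1⟩
    obtain ⟨hnK, hvK⟩ := hmem K hbK
    obtain ⟨hnJ, hvJ⟩ := hmem J hb
    set Φ : Val C N → Val C N := replace (.null n) v with hΦ
    have hΦc : ∀ c, Φ (.const c) = .const c := replace_const n v
    have hdK : dom (Atom.map Φ '' K) ⊆ dom K := by
      rw [dom_map_image]
      rintro _ ⟨w, hw, rfl⟩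
      by_cases h : w = .null n
      · rw [h, hΦ, replace_self]; exact hvK
      · rw [hΦ, replace_of_ne h]; exact hw
    -- After the EGD step, γ is triggered by the renamed tuple. If γ is a TGD, its fresh nulls
    -- differ from `n`, which occurs in `K`, so `Φ` leaves them alone.
    refine ⟨Atom.map Φ '' K, Φ ∘ τ, ⟨hbK, hxy, equates_iff.2 ⟨n, v, hnv, rfl⟩⟩, ?_,
      hdK.trans Set.subset_union_left, fun k h1 h2 => (h2 (hdK h1)).elim⟩
    cases γ with
    | tgd body₂ head₂ hh₂ =>
      obtain ⟨hb₂, ν₂, hν₂, hf₂, hinj₂, rfl⟩ := hγ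
      have hΦν : ∀ y ∈ vars (head₂ : Set (Atom ar (Term C V))) \
          vars (body₂ : Set (Atom ar (Term C V))),
          (Φ ∘ ν₂) y = ν₂ y := by
        intro y hy
        obtain ⟨k, h1, h2⟩ := hf₂ y hy
        apply replace_of_ne
        rw [h1]
        rintro h
        exact h2 (h ▸ hnK)
      refine ⟨?_, Φ ∘ ν₂, fun y hy => congrArg Φ (hν₂ hy), fun y hy => ?_, ?_, ?_⟩
      · rw [← map_image hΦc]
        exact Set.image_mono hb₂
      · obtain ⟨k, h1, h2⟩ := hf₂ y hy
        exact ⟨k, (hΦν y hy).trans h1, fun h => h2 (hdK h)⟩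
      · intro y hy z hz hyz
        rw [hΦν y hy, hΦν z hz] at hyz
        exact hinj₂ hy hz hyz
      · rw [Set.image_union, map_image hΦc]
    | egd body₂ x₂ y₂ hne₂ hx₂ hy₂ =>
      obtain ⟨hb₂, hxy₂, he₂⟩ := hγ
      obtain ⟨m, w, hmw, rfl⟩ := equates_iff.1 he₂
      have hw : w ≠ .null m := by
        rcases hmw with ⟨h1, h2⟩ | ⟨h1, h2⟩
        · rw [← h1, ← h2]; exact hxy₂.symm
        · rw [← h1, ← h2]; exact hxy₂
      -- The null `m` eliminated by γ is absent from `J`, where `n` and `v` still occur. So `m` is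
      -- neither of them, and `Φ` cannot identify the two sides of γ's equation.
      have hmJ : ∀ u ∈ dom (Atom.map (replace (.null m) w) '' K), u ≠ .null m := by
        rw [dom_map_image]
        rintro _ ⟨u, -, rfl⟩
        exact replace_ne hw u
      have hnm := hmJ _ hnJ
      have hvm := hmJ _ hvJ
      have hΦm : Φ (.null m) = .null m := replace_of_ne hnm.symm
      have hΦw : Φ w ≠ .null m := by
        by_cases h : w = .null n
        · rw [h, hΦ, replace_self]; exact hvm
        · rwa [hΦ, replace_of_ne h]
      refine ⟨?_, ?_, equates_iff.2 ⟨m, Φ w, ?_, ?_⟩⟩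
      · rw [← map_image hΦc]
        exact Set.image_mono hb₂
      · rcases hmw with ⟨h1, h2⟩ | ⟨h1, h2⟩
        · simp only [Function.comp_apply, h1, h2, hΦm]; exact hΦw.symm
        · simp only [Function.comp_apply, h1, h2, hΦm]; exact hΦw
      · rcases hmw with ⟨h1, h2⟩ | ⟨h1, h2⟩
        · left; simp [h1, h2, hΦm]
        · right; simp [h1, h2, hΦm]
      · rw [map_map_image, map_map_image]
        apply map_congr
        intro u _
        simp only [Function.comp_apply]
        by_cases h : u = .null m
        · rw [h, replace_self, hΦm, replace_self]
        · rw [replace_of_ne h]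
          by_cases h' : u = .null n
          · rw [h', hΦ, replace_self, replace_of_ne hvm]
          · rw [hΦ, replace_of_ne h', replace_of_ne h]

end Steps

/-! ### Renaming nulls so that none is reused -/

section Normalize

theorem exists_fresh_equiv [Infinite N] {A B F : Set (Val C N)} (hA : A.Finite) (hB : B.Finite)
    (hF : F.Finite) : ∃ e : Val C N ≃ Val C N, (∀ c, e (.const c) = .const c) ∧
      (∀ v ∈ A, e v = v) ∧ ∀ n : N, Val.null n ∈ B → Val.null n ∉ A → e (.null n) ∉ F := by
  classical
  induction B, hB using Set.Finite.induction_on with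
  | empty => exact ⟨Equiv.refl _, fun _ => rfl, fun _ _ => rfl, fun _ h => h.elim⟩
  | @insert b B hb hB ih =>
    obtain ⟨e, he, heA, heB⟩ := ih
    by_cases hbA : b ∈ A
    · refine ⟨e, he, heA, fun n hn hnA => heB n (hn.resolve_left ?_) hnA⟩
      rintro rfl
      exact hnA hbA
    rcases b with c | k
    · exact ⟨e, he, heA, fun n hn hnA => heB n (hn.resolve_left (by simp)) hnA⟩
    · have hfin : ((fun n : N => (Val.null n : Val C N)) ⁻¹' (A ∪ F ∪ e '' B)).Finite :=
        ((hA.union hF).union (hB.image _)).preimage fun _ _ _ _ h => by simpa using h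
      obtain ⟨d, hd⟩ := hfin.exists_notMem
      simp only [Set.mem_preimage, Set.mem_union, not_or] at hd
      obtain ⟨⟨hdA, hdF⟩, hdB⟩ := hd
      -- Redirect `k` to an unused null `d`. Neither swapped element lies in `A` or in the image of
      -- `B`, so what was arranged before is kept.
      refine ⟨e.trans (Equiv.swap (e (.null k)) (.null d)), fun c => ?_, fun v hv => ?_,
        fun n hn hnA => ?_⟩
      · rw [Equiv.trans_apply, he, Equiv.swap_apply_of_ne_of_ne]
        · rw [← he c]
          exact e.injective.ne (by simp)
        · simp
      · rw [Equiv.trans_apply, Equiv.swap_apply_of_ne_of_ne, heA v hv]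
        · refine e.injective.ne ?_
          rintro rfl
          exact hbA hv
        · rw [heA v hv]
          rintro rfl
          exact hdA hv
      · rw [Equiv.trans_apply]
        by_cases h : n = k
        · rw [h, Equiv.swap_apply_left]
          exact hdF
        · have hnB : Val.null n ∈ B := hn.resolve_left (by simpa using h)
          rw [Equiv.swap_apply_of_ne_of_ne]
          · exact heB n hnB hnA
          · exact e.injective.ne (by simpa using h)
          · exact fun h' => hdB ⟨_, hnB, h'⟩

/-- The elements occurring in the first `j + 1` members of a sequence. -/
def domUpTo (s : ℕ → Set (Atom ar (Val C N))) (j : ℕ) : Set (Val C N) :=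
  {v | ∃ i ≤ j, v ∈ dom (s i)}

theorem domUpTo_mono (s : ℕ → Set (Atom ar (Val C N))) : Monotone (domUpTo s) :=
  fun _ _ h _ ⟨i, hi, hv⟩ => ⟨i, hi.trans h, hv⟩

theorem domUpTo_succ (s : ℕ → Set (Atom ar (Val C N))) (j : ℕ) :
    domUpTo s (j + 1) = domUpTo s j ∪ dom (s (j + 1)) := by
  ext v
  constructor
  · rintro ⟨i, hi, hv⟩
    rcases hi.eq_or_lt with rfl | h
    · exact Or.inr hv
    · exact Or.inl ⟨i, by omega, hv⟩
  · rintro (⟨i, hi, hv⟩ | hv)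
    · exact ⟨i, by omega, hv⟩
    · exact ⟨_, le_rfl, hv⟩

theorem domUpTo_congr {s s' : ℕ → Set (Atom ar (Val C N))} {j : ℕ} (h : ∀ i ≤ j, s i = s' i) :
    domUpTo s j = domUpTo s' j := by
  ext v
  constructor
  · rintro ⟨i, hi, hv⟩
    exact ⟨i, hi, h i hi ▸ hv⟩
  · rintro ⟨i, hi, hv⟩
    exact ⟨i, hi, (h i hi).symm ▸ hv⟩

/-- The first `m` steps of `s` apply the constraints `α` with the parameters `σ`. -/
def Steps (α : ℕ → Constraint ar C V) (σ : ℕ → V → Val C N) (s : ℕ → Set (Atom ar (Val C N)))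
    (m : ℕ) : Prop :=
  ∀ j < m, Step (α j) (σ j) (s j) (s (j + 1))

theorem Steps.finite {α : ℕ → Constraint ar C V} {σ : ℕ → V → Val C N}
    {s : ℕ → Set (Atom ar (Val C N))} {m : ℕ} (h : Steps α σ s m) (h0 : (s 0).Finite) :
    ∀ j ≤ m, (s j).Finite := by
  intro j hj
  induction j with
  | zero => exact h0
  | succ j ih => exact finite_of_step (h j hj) (ih (by omega))

/-- No null that has disappeared is used again in the first `m` steps. -/
def NoReuse (s : ℕ → Set (Atom ar (Val C N))) (m : ℕ) : Prop :=
  ∀ j < m, ∀ n : N, Val.null n ∈ dom (s (j + 1)) → Val.null n ∈ domUpTo s j → Val.null n ∈ dom (s j)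

/-- Up to renaming of nulls, a chase sequence never reuses a null. -/
theorem exists_noReuse [Infinite N] {α : ℕ → Constraint ar C V} {σ : ℕ → V → Val C N}
    {s : ℕ → Set (Atom ar (Val C N))} {m : ℕ} (h0 : (s 0).Finite) (h : Steps α σ s m) :
    ∃ s' σ', s' 0 = s 0 ∧ Steps α σ' s' m ∧ NoReuse s' m ∧
      ∃ e : Val C N ≃ Val C N, (∀ c, e (.const c) = .const c) ∧ s' m = Atom.map e '' s m := by
  induction m with
  | zero =>
    exact ⟨s, σ, rfl, h, fun j hj => absurd hj (Nat.not_lt_zero _), Equiv.refl _, fun _ => rfl,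
      (map_id_image _).symm⟩
  | succ m ih =>
    obtain ⟨s', σ', hs0, hs', hr, e, he, hem⟩ := ih fun j hj => h j (by omega)
    have hfin := hs'.finite (hs0 ▸ h0)
    have hm := (h m (by omega)).map e he
    have hF : (domUpTo s' m).Finite := by
      have : domUpTo s' m = ⋃ i ∈ Set.Iic m, dom (s' i) := by
        ext v; simp [domUpTo]
      rw [this]
      exact (Set.finite_Iic m).biUnion fun i hi => finite_dom (hfin i hi)
    rw [← hem] at hm
    obtain ⟨f, hf, hfA, hfB⟩ := exists_fresh_equiv (finite_dom (hfin m le_rfl))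
      (finite_dom (finite_of_step hm (hfin m le_rfl))) hF
    have hm' := hm.map f hf
    have hfm : Atom.map f '' s' m = s' m := by
      conv_rhs => rw [← map_id_image (s' m)]
      exact map_congr hfA
    rw [hfm] at hm'
    -- Only the new last instance is renamed by `f`. As `f` fixes `dom (s' m)`, the last step still
    -- starts in `s' m`.
    refine ⟨fun j => if j ≤ m then s' j else Atom.map f '' (Atom.map e '' s (m + 1)),
      fun j => if j < m then σ' j else f ∘ e ∘ σ m, by simpa using hs0, fun j hj => ?_, ?_,
      e.trans f, fun c => by simp [he, hf], ?_⟩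
    · rcases (Nat.lt_succ_iff.1 hj).eq_or_lt with rfl | hj
      · simpa using hm'
      · simpa [hj, hj.le, Nat.succ_le_of_lt hj] using hs' j hj
    · intro j hj n hn hn'
      have hcong : domUpTo (fun j => if j ≤ m then s' j else
          Atom.map f '' (Atom.map e '' s (m + 1))) j = domUpTo s' j :=
        domUpTo_congr fun i hi => by rw [if_pos (by omega)]
      rw [hcong] at hn'
      rcases (Nat.lt_succ_iff.1 hj).eq_or_lt with rfl | hj
      · simp only [le_refl, if_true]
        simp only [Nat.not_succ_le_self, if_false] at hn
        rw [dom_map_image] at hn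
        obtain ⟨v, hv, hvn⟩ := hn
        by_cases hvA : v ∈ dom (s' j)
        · rw [← hvn, hfA v hvA]
          exact hvA
        · rcases v with c | k
          · simp [hf] at hvn
          · exact absurd (hvn ▸ hn') (hfB k hv hvA)
      · simp only [hj.le, if_true]
        simp only [Nat.succ_le_of_lt hj, if_true] at hn
        exact hr j hj n hn hn'
    · simp only [Nat.not_succ_le_self, if_false]
      rw [map_map_image]
      rfl

end Normalize

/-! ### Separating the D-steps from the rest -/

section Reorder

/-- `J` is reached from `K` by oblivious steps with constraints from `E` on finite instances over
elements of `U`. -/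
def ObliviousPath (E : Set (Constraint ar C V)) (U : Set (Val C N)) :
    Set (Atom ar (Val C N)) → Set (Atom ar (Val C N)) → Prop :=
  Relation.ReflTransGen fun A B => A.Finite ∧ dom A ⊆ U ∧ ∃ γ ∈ E, ∃ τ, ObliviousStep γ τ A B

theorem ObliviousPath.mono {E : Set (Constraint ar C V)} {U U' : Set (Val C N)} (hU : U ⊆ U')
    {K J : Set (Atom ar (Val C N))} (h : ObliviousPath E U K J) : ObliviousPath E U' K J :=
  Relation.ReflTransGen.mono (fun _ _ ⟨h1, h2, h3⟩ => ⟨h1, h2.trans hU, h3⟩) _ _ h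

/-- A step on the path from satisfied to violated would be an instance of ≺_c, so violation
propagates backwards. -/
theorem not_satisfies_of_obliviousPath {E : Set (Constraint ar C V)} {U : Set (Val C N)}
    {K J : Set (Atom ar (Val C N))} (h : ObliviousPath E U K J) {β : Constraint ar C V}
    (hE : ∀ γ ∈ E, ¬ PrecC N γ β) {τ : V → Val C N} (hJ : ¬ Satisfies J β τ) :
    ¬ Satisfies K β τ := by
  induction h using Relation.ReflTransGen.head_induction_on with
  | refl => exact hJ
  | head h _ ih =>
    obtain ⟨hfin, -, γ, hγ, υ, hstep⟩ := h
    exact fun hs => hE γ hγ ⟨_, _, υ, τ, hfin, hs, hstep, ih⟩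

/-- The step with `α` is moved back over one oblivious step at a time. The last conjunct passes the
freshness assumption on to the next exchange; for this `U` has to contain the domains of the
instances passed. -/
theorem ObliviousPath.exists_commute {E : Set (Constraint ar C V)} {U : Set (Val C N)}
    {K J J' : Set (Atom ar (Val C N))} (h : ObliviousPath E U K J)
    {α : Constraint ar C V} (hE : ∀ γ ∈ E, ¬ PrecC N γ α) {σ : V → Val C N} (hα : Step α σ J J')
    (hfresh : ∀ n : N, Val.null n ∈ dom J' → Val.null n ∈ U → Val.null n ∈ dom J) :
    ∃ K', Step α σ K K' ∧ ObliviousPath E (U ∪ dom J') K' J' ∧ dom K' ⊆ U ∪ dom J' ∧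
      ∀ n : N, Val.null n ∈ dom K' → Val.null n ∈ U → Val.null n ∈ dom K := by
  induction h using Relation.ReflTransGen.head_induction_on with
  | refl => exact ⟨J', hα, Relation.ReflTransGen.refl, Set.subset_union_right, hfresh⟩
  | @head K K₁ h hp ih =>
    obtain ⟨hfin, hKU, γ, hγ, υ, hstep⟩ := h
    obtain ⟨K₁', h1, h2, h3, h4⟩ := ih
    have hK : ¬ Satisfies K α σ :=
      fun hs => hE γ hγ ⟨_, _, υ, σ, hfin, hs, hstep, not_satisfies_of_step h1⟩
    obtain ⟨K', υ', h5, h6, h7, h8⟩ := Chase.exists_commute hstep h1 hK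
      fun n hn hn' => h4 n hn (hKU hn')
    have h9 : dom K' ⊆ U ∪ dom J' :=
      h7.trans (Set.union_subset (hKU.trans Set.subset_union_left) h3)
    refine ⟨K', h5, Relation.ReflTransGen.head ⟨finite_of_step h5 hfin, h9, γ, hγ, υ', h6⟩ h2, h9,
      fun n hn hnU => ?_⟩
    by_contra hc
    obtain ⟨h10, h11⟩ := h8 n hn hc
    exact h10 (h4 n h11 hnU)

/-- If no constraint of `E` precedes one of `D`, the steps with constraints from `D` can be
executed without those from `E`. -/
theorem exists_subchase {D E : Set (Constraint ar C V)} (hED : ∀ γ ∈ E, ∀ δ ∈ D, ¬ PrecC N γ δ)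
    {α : ℕ → Constraint ar C V} {σ : ℕ → V → Val C N} {s : ℕ → Set (Atom ar (Val C N))} {m : ℕ}
    (h0 : (s 0).Finite) (h : Steps α σ s m) (hr : NoReuse s m)
    (hα : ∀ j < m, α j ∉ D → α j ∈ E) :
    ∃ K : ℕ → Set (Atom ar (Val C N)), K 0 = s 0 ∧
      (∀ j ≤ m, ObliviousPath E (domUpTo s j) (K j) (s j)) ∧
      ∀ j < m, (α j ∈ D → Step (α j) (σ j) (K j) (K (j + 1))) ∧ (α j ∉ D → K (j + 1) = K j) := by
  induction m with
  | zero =>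
    refine ⟨s, rfl, fun j hj => ?_, fun j hj => absurd hj (Nat.not_lt_zero _)⟩
    exact Relation.ReflTransGen.refl
  | succ m ih =>
    obtain ⟨K, hK0, hK, hKs⟩ := ih (fun j hj => h j (by omega)) (fun j hj => hr j (by omega))
      fun j hj => hα j (by omega)
    suffices hX : ∃ X, ObliviousPath E (domUpTo s (m + 1)) X (s (m + 1)) ∧
        (α m ∈ D → Step (α m) (σ m) (K m) X) ∧ (α m ∉ D → X = K m) by
      obtain ⟨X, hX1, hX2, hX3⟩ := hX
      refine ⟨fun j => if j ≤ m then K j else X, by simpa using hK0, fun j hj => ?_, fun j hj => ?_⟩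
      · rcases hj.eq_or_lt with rfl | hj
        · simpa using hX1
        · simpa [Nat.lt_succ_iff.1 hj] using hK j (by omega)
      · rcases (Nat.lt_succ_iff.1 hj).eq_or_lt with rfl | hj
        · simpa using ⟨hX2, hX3⟩
        · simpa [hj.le, Nat.succ_le_of_lt hj] using hKs j hj
    by_cases hm : α m ∈ D
    · obtain ⟨X, h1, h2, -⟩ := (hK m le_rfl).exists_commute
        (fun γ hγ => hED γ hγ _ hm) (h m (by omega)) (hr m (by omega))
      refine ⟨X, ?_, fun _ => h1, fun h => (h hm).elim⟩
      rwa [domUpTo_succ]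
    -- A step outside `D` leaves `K` idle and is appended to the oblivious path.
    · refine ⟨K m, ?_, fun h => (hm h).elim, fun _ => rfl⟩
      refine ((hK m le_rfl).mono (domUpTo_mono s (Nat.le_succ m))).tail
        ⟨h.finite h0 m (by omega), fun v hv => ⟨m, by omega, hv⟩, α m, hα m (by omega) hm, σ m,
          obliviousStep_of_step (h m (by omega))⟩

open Classical in
/-- The number of the first `m` steps that use constraints from `D`. -/
noncomputable def stepCount (α : ℕ → Constraint ar C V) (D : Set (Constraint ar C V)) (m : ℕ) : ℕ :=
  ((Finset.range m).filter fun j => α j ∈ D).card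

theorem stepCount_zero (α : ℕ → Constraint ar C V) (D : Set (Constraint ar C V)) :
    stepCount α D 0 = 0 := by simp [stepCount]

theorem stepCount_succ_of_mem {α : ℕ → Constraint ar C V} {D : Set (Constraint ar C V)} {m : ℕ}
    (h : α m ∈ D) : stepCount α D (m + 1) = stepCount α D m + 1 := by
  simp [stepCount, Finset.range_add_one, Finset.filter_insert, h]

theorem stepCount_succ_of_notMem {α : ℕ → Constraint ar C V} {D : Set (Constraint ar C V)} {m : ℕ}
    (h : α m ∉ D) : stepCount α D (m + 1) = stepCount α D m := by
  simp [stepCount, Finset.range_add_one, Finset.filter_insert, h]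

theorem stepCount_mono (α : ℕ → Constraint ar C V) (D : Set (Constraint ar C V)) :
    Monotone (stepCount α D) := by
  apply monotone_nat_of_le_succ
  intro m
  by_cases h : α m ∈ D
  · rw [stepCount_succ_of_mem h]; omega
  · rw [stepCount_succ_of_notMem h]

theorem notMem_of_stepCount_eq {α : ℕ → Constraint ar C V} {D : Set (Constraint ar C V)}
    {i j k : ℕ} (h : stepCount α D i = stepCount α D j) (hik : i ≤ k) (hkj : k < j) : α k ∉ D := by
  intro hk
  have h1 := stepCount_mono α D hik
  have h2 := stepCount_mono α D (Nat.succ_le_of_lt hkj)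
  have h3 := stepCount_succ_of_mem hk
  simp only [Nat.succ_eq_add_one] at h2
  omega

/-- Every chase sequence with constraints from `D` that starts in `I` has length at most `q`. -/
def ChaseBound (D : Set (Constraint ar C V)) (I : Set (Atom ar (Val C N))) (q : ℕ) : Prop :=
  ∀ (α : ℕ → Constraint ar C V) (σ : ℕ → V → Val C N) (s : ℕ → Set (Atom ar (Val C N))) (m : ℕ),
    s 0 = I → (∀ j < m, α j ∈ D) → Steps α σ s m → m ≤ q

/-- Idle steps do not count. -/
theorem ChaseBound.stepCount_le {D : Set (Constraint ar C V)} {I : Set (Atom ar (Val C N))} {q : ℕ}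
    (h : ChaseBound D I q) {α : ℕ → Constraint ar C V} {σ : ℕ → V → Val C N}
    {K : ℕ → Set (Atom ar (Val C N))} {m : ℕ} (h0 : K 0 = I)
    (hK : ∀ j < m, (α j ∈ D → Step (α j) (σ j) (K j) (K (j + 1))) ∧
      (α j ∉ D → K (j + 1) = K j)) : stepCount α D m ≤ q := by
  suffices ∃ (α' : ℕ → Constraint ar C V) (σ' : ℕ → V → Val C N)
      (s : ℕ → Set (Atom ar (Val C N))), s 0 = I ∧ s (stepCount α D m) = K m ∧
      (∀ j < stepCount α D m, α' j ∈ D) ∧ Steps α' σ' s (stepCount α D m) by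
    obtain ⟨α', σ', s, h1, -, h2, h3⟩ := this
    exact h α' σ' s _ h1 h2 h3
  induction m with
  | zero =>
    refine ⟨α, σ, K, h0, by rw [stepCount_zero], ?_, ?_⟩ <;>
    · rw [stepCount_zero]
      exact fun j hj => absurd hj (Nat.not_lt_zero _)
  | succ m ih =>
    obtain ⟨α', σ', s, h1, h2, h3, h4⟩ := ih fun j hj => hK j (by omega)
    by_cases hm : α m ∈ D
    · rw [stepCount_succ_of_mem hm]
      generalize stepCount α D m = k at h2 h3 h4
      have hst := (hK m (by omega)).1 hm
      refine ⟨fun j => if j < k then α' j else α m, fun j => if j < k then σ' j else σ m,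
        fun j => if j ≤ k then s j else K (m + 1), by simpa using h1, by simp, fun j hj => ?_,
        fun j hj => ?_⟩
      · by_cases hjk : j < k
        · simpa [hjk] using h3 j hjk
        · simpa [hjk] using hm
      · rcases (Nat.lt_succ_iff.1 hj).eq_or_lt with rfl | hj
        · simpa [h2] using hst
        · simpa [hj, hj.le, Nat.succ_le_of_lt hj] using h4 j hj
    · rw [stepCount_succ_of_notMem hm]
      exact ⟨α', σ', s, h1, h2.trans ((hK m (by omega)).2 hm).symm, h3, h4⟩

end Reorder

/-! ### Step counts and the size of the domain -/

section Count

theorem stepCount_add_compl (α : ℕ → Constraint ar C V) (D : Set (Constraint ar C V)) (m : ℕ) :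
    stepCount α D m + stepCount α Dᶜ m = m := by
  induction m with
  | zero => simp [stepCount_zero]
  | succ m ih =>
    by_cases h : α m ∈ D
    · rw [stepCount_succ_of_mem h, stepCount_succ_of_notMem (by simpa using h)]
      omega
    · rw [stepCount_succ_of_notMem h, stepCount_succ_of_mem (by simpa using h)]
      omega

theorem stepCount_le_add (α : ℕ → Constraint ar C V) {D D₁ D₂ : Set (Constraint ar C V)}
    (h : D ⊆ D₁ ∪ D₂) (m : ℕ) : stepCount α D m ≤ stepCount α D₁ m + stepCount α D₂ m := by
  classical
  unfold stepCount
  refine (Finset.card_le_card fun j hj => ?_).trans (Finset.card_union_le _ _)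
  simp only [Finset.mem_filter, Finset.mem_union] at hj ⊢
  exact (h hj.2).imp (fun h => ⟨hj.1, h⟩) fun h => ⟨hj.1, h⟩

/-- `W` contains the variables and `Z` the constants in the heads of the constraints of `S`. -/
def CoversSymbols (S : Set (Constraint ar C V)) (W : Finset V) (Z : Finset C) : Prop :=
  ∀ α ∈ S, vars (α.body : Set (Atom ar (Term C V))) ⊆ W ∧
    vars (α.head : Set (Atom ar (Term C V))) ⊆ W ∧
    ∀ c, Term.const c ∈ dom (α.head : Set (Atom ar (Term C V))) → c ∈ Z

theorem exists_coversSymbols {S : Set (Constraint ar C V)} (h : S.Finite) :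
    ∃ W Z, CoversSymbols S W Z := by
  have h1 : (⋃ α ∈ S, (vars (α.body : Set (Atom ar (Term C V))) ∪
      vars (α.head : Set (Atom ar (Term C V))))).Finite :=
    h.biUnion fun α _ =>
      (finite_vars (Finset.finite_toSet _)).union (finite_vars (Finset.finite_toSet _))
  have h2 : (⋃ α ∈ S, {c | Term.const c ∈ dom (α.head : Set (Atom ar (Term C V)))}).Finite :=
    h.biUnion fun α _ => finite_consts (Finset.finite_toSet _)
  refine ⟨h1.toFinset, h2.toFinset, fun α hα => ⟨fun x hx => ?_, fun x hx => ?_, fun c hc => ?_⟩⟩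
  · rw [Set.Finite.coe_toFinset]
    exact Set.mem_biUnion hα (Or.inl hx)
  · rw [Set.Finite.coe_toFinset]
    exact Set.mem_biUnion hα (Or.inr hx)
  · rw [Set.Finite.mem_toFinset]
    exact Set.mem_biUnion hα hc

theorem StepData.dom_subset {α : Constraint ar C V} {σ : V → Val C N}
    {I J : Set (Atom ar (Val C N))} {ρ : Val C N → Val C N} {ν : V → Val C N}
    (h : StepData α σ I J ρ ν) {W : Finset V} {Z : Finset C} (hW : CoversSymbols {α} W Z) :
    dom J ⊆ dom I ∪ (ν '' W ∪ Val.const '' Z) := by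
  rw [h.eq_union, dom_union, dom_map_image]
  apply Set.union_subset_union
  · rintro _ ⟨v, hv, rfl⟩
    exact h.map_dom v hv
  · intro v hv
    rcases mem_dom_image hv with ⟨x, hx, rfl⟩ | ⟨c, hc, rfl⟩
    · exact Or.inl ⟨x, (hW α rfl).2.1 hx, rfl⟩
    · exact Or.inr ⟨c, (hW α rfl).2.2 c hc, rfl⟩

theorem CoversSymbols.mono {S S' : Set (Constraint ar C V)} {W : Finset V} {Z : Finset C}
    (h : CoversSymbols S W Z) (hS : S' ⊆ S) : CoversSymbols S' W Z :=
  fun α hα => h α (hS hα)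

theorem ncard_image_union_le {T T' T'' : Type*} (f : T → T'') (g : T' → T'') (W : Finset T)
    (Z : Finset T') : (f '' (W : Set T) ∪ g '' (Z : Set T')).ncard ≤ W.card + Z.card := by
  refine (Set.ncard_union_le _ _).trans (add_le_add ?_ ?_)
  · exact (Set.ncard_image_le (Finset.finite_toSet _)).trans_eq (Set.ncard_coe_finset _)
  · exact (Set.ncard_image_le (Finset.finite_toSet _)).trans_eq (Set.ncard_coe_finset _)

/-- The steps that are not TGD steps decrease the size of the domain. -/
theorem stepCount_add_ncard_dom_le {S : Set (Constraint ar C V)} {W : Finset V} {Z : Finset C}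
    (hW : CoversSymbols S W Z) {α : ℕ → Constraint ar C V} {σ : ℕ → V → Val C N}
    {s : ℕ → Set (Atom ar (Val C N))} {m : ℕ} (h0 : (s 0).Finite) (h : Steps α σ s m)
    (hα : ∀ j < m, α j ∈ S) :
    stepCount α {γ | γ.head.Nonempty}ᶜ m + (dom (s m)).ncard ≤
      (dom (s 0)).ncard + (W.card + Z.card) * stepCount α {γ | γ.head.Nonempty} m := by
  induction m with
  | zero => simp [stepCount_zero]
  | succ m ih =>
    have ih := ih (fun j hj => h j (by omega)) fun j hj => hα j (by omega)
    have hfin := finite_dom (h.finite h0 m (by omega))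
    obtain ⟨ρ, ν, hd⟩ := exists_stepData (h m (by omega))
    by_cases hm : (α m).head.Nonempty
    · rw [stepCount_succ_of_mem (D := {γ | γ.head.Nonempty}) hm,
        stepCount_succ_of_notMem (D := {γ | γ.head.Nonempty}ᶜ) (fun h => h hm)]
      have hsub := hd.dom_subset (hW.mono (Set.singleton_subset_iff.2 (hα m (by omega))))
      have h1 := (Set.ncard_le_ncard hsub (hfin.union
        (((Finset.finite_toSet _).image _).union ((Finset.finite_toSet _).image _)))).trans
        (Set.ncard_union_le _ _)
      have h2 := ncard_image_union_le ν (Val.const (C := C) (N := N)) W Z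
      rw [mul_add, mul_one]
      omega
    · rw [stepCount_succ_of_notMem (D := {γ | γ.head.Nonempty}) hm,
        stepCount_succ_of_mem (D := {γ | γ.head.Nonempty}ᶜ) (by simpa using hm)]
      have hJ : dom (s (m + 1)) = ρ '' dom (s m) := by
        rw [hd.eq_union, Finset.not_nonempty_iff_eq_empty.1 hm]
        simp [image, dom_map_image]
      obtain ⟨a, ha, b, hb, hab, hρ⟩ := hd.collapse hm
      have h1 : (dom (s (m + 1))).ncard < (dom (s m)).ncard := by
        rw [hJ]
        refine lt_of_le_of_ne (Set.ncard_image_le hfin) fun h => hab ?_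
        exact Set.injOn_of_ncard_image_eq h hfin ha hb hρ
      omega

end Count

/-! ### A single constraint that does not precede itself -/

section Singleton

/-- Steps with a constraint that does not precede itself are triggered by values of the chase
with the remaining constraints. -/
theorem stepCount_singleton_le [Nonempty C] {S D : Set (Constraint ar C V)} {β : Constraint ar C V}
    {W : Finset V} {Z : Finset C} (hW : CoversSymbols S W Z)
    (hβ : ¬ PrecC N β β) {α : ℕ → Constraint ar C V}
    {σ : ℕ → V → Val C N} {s K : ℕ → Set (Atom ar (Val C N))} {m : ℕ}
    (h0 : (s 0).Finite) (h : Steps α σ s m) (hα : ∀ j < m, α j ∈ S)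
    (hD : ∀ j < m, α j ∉ D → α j = β)
    (hK0 : K 0 = s 0) (hK : ∀ j ≤ m, ObliviousPath {β} (domUpTo s j) (K j) (s j))
    (hKs : ∀ j < m, (α j ∈ D → Step (α j) (σ j) (K j) (K (j + 1))) ∧
      (α j ∉ D → K (j + 1) = K j)) :
    stepCount α {β} m ≤ (stepCount α D m + 1) *
      ((dom (s 0)).ncard + (W.card + Z.card) * stepCount α D m + 1) ^ W.card := by
  classical
  have hself : ∀ γ ∈ ({β} : Set (Constraint ar C V)), ¬ PrecC N γ β := by
    rintro γ rfl
    exact hβ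
  have hfin := h.finite h0
  -- `X` collects the values of the whole sequence `K`, which changes at D-steps only, each adding
  -- at most the values of `W` and `Z`.
  have hX : ∃ X : Finset (Val C N), (∀ j ≤ m, dom (K j) ⊆ X) ∧
      X.card ≤ (dom (s 0)).ncard + (W.card + Z.card) * stepCount α D m := by
    clear hK hD h hfin
    induction m with
    | zero =>
      refine ⟨(finite_dom h0).toFinset, fun j hj => ?_, ?_⟩
      · rw [Nat.le_zero.1 hj, hK0]
        simp
      · rw [← Set.ncard_eq_toFinset_card _ (finite_dom h0)]
        omega
    | succ m ih =>
      obtain ⟨X, hX, hc⟩ := ih (fun j hj => hα j (by omega)) fun j hj => hKs j (by omega)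
      by_cases hm : α m ∈ D
      · obtain ⟨ρ, ν, hd⟩ := exists_stepData ((hKs m (by omega)).1 hm)
        have hsub := hd.dom_subset (hW.mono (Set.singleton_subset_iff.2 (hα m (by omega))))
        refine ⟨X ∪ (W.image ν ∪ Z.image Val.const), fun j hj => ?_, ?_⟩
        · push_cast
          rcases hj.eq_or_lt with rfl | hj
          · exact hsub.trans (Set.union_subset_union_left _ (hX m le_rfl))
          · exact (hX j (by omega)).trans Set.subset_union_left
        · rw [stepCount_succ_of_mem hm, mul_add, mul_one, ← add_assoc]
          refine (Finset.card_union_le _ _).trans (add_le_add hc ?_)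
          exact (Finset.card_union_le _ _).trans
            (add_le_add Finset.card_image_le Finset.card_image_le)
      · rw [stepCount_succ_of_notMem hm]
        refine ⟨X, fun j hj => ?_, hc⟩
        rcases hj.eq_or_lt with rfl | hj
        · rw [(hKs m (by omega)).2 hm]
          exact hX m le_rfl
        · exact hX j (by omega)
  obtain ⟨X, hX, hXc⟩ := hX
  obtain ⟨c₀⟩ := ‹Nonempty C›
  -- A β-step is coded by the number of D-steps before it and its trigger. The default `c₀` on
  -- variables outside the body accounts for the `+ 1` in the base of the power.
  set f : ℕ → ℕ × (W → Val C N) := fun j => (stepCount α D j,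
    fun x => if (x : V) ∈ vars (β.body : Set (Atom ar (Term C V))) then σ j x else .const c₀)
    with hf
  set T : Finset (ℕ × (W → Val C N)) := Finset.range (stepCount α D m + 1) ×ˢ
    Fintype.piFinset fun _ : W => insert (Val.const c₀) X with hT
  have hTc : T.card ≤ (stepCount α D m + 1) *
      ((dom (s 0)).ncard + (W.card + Z.card) * stepCount α D m + 1) ^ W.card := by
    rw [hT, Finset.card_product, Finset.card_range, Fintype.card_piFinset, Finset.prod_const,
      Finset.card_univ, Fintype.card_coe]
    gcongr
    exact (Finset.card_insert_le _ _).trans (by omega)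
  refine le_trans ?_ hTc
  unfold stepCount
  apply Finset.card_le_card_of_injOn f
  · intro j hj
    simp only [Finset.coe_filter, Finset.mem_range, Set.mem_ofPred_eq, Set.mem_singleton_iff] at hj
    obtain ⟨hjm, hj⟩ := hj
    rw [Finset.mem_coe, hT, Finset.mem_product]
    refine ⟨Finset.mem_range.2 (Nat.lt_succ_of_le (stepCount_mono α D hjm.le)), ?_⟩
    rw [Fintype.mem_piFinset]
    intro x
    simp only [hf]
    split_ifs with hx
    · apply Finset.mem_insert_of_mem
      have hst := not_satisfies_of_step (h j hjm)
      rw [hj] at hst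
      have hb := body_subset_of_not_satisfies
        (not_satisfies_of_obliviousPath (hK j hjm.le) hself hst)
      exact hX j hjm.le (dom_mono hb (apply_mem_dom_image hx _))
    · exact Finset.mem_insert_self _ _
  · have key : ∀ i j, i < j → j < m → α i = β → α j = β → f i ≠ f j := by
      intro i j hij hjm hi hj hfij
      simp only [hf, Prod.mk.injEq] at hfij
      obtain ⟨hc, hv⟩ := hfij
      -- Equal counts mean that only β-steps occur between `i` and `j`; β ⊀_c β then keeps the
      -- instance handled at step `i` satisfied.
      have hsat : ∀ k, i + 1 ≤ k → k ≤ j → Satisfies (s k) β (σ i) := by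
        intro k hik
        induction k, hik using Nat.le_induction with
        | base =>
          intro _
          have := satisfies_of_step (h i (by omega))
          rwa [hi] at this
        | succ k hik ih =>
          intro hkj
          by_contra hns
          have hk := hD k (by omega) (notMem_of_stepCount_eq hc (by omega) (by omega))
          have hst := obliviousStep_of_step (h k (by omega))
          rw [hk] at hst
          exact hβ ⟨_, _, _, _, hfin k (by omega), ih (by omega), hst, hns⟩
      have hst := not_satisfies_of_step (h j hjm)
      rw [hj] at hst
      refine hst ((hsat j hij le_rfl).congr fun x hx => ?_)
      have hxW : x ∈ W := (hW β (hj ▸ hα j hjm)).1 hx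
      have := congrFun hv ⟨x, hxW⟩
      simpa [hx] using this
    intro i hi j hj hij
    simp only [Finset.coe_filter, Finset.mem_range, Set.mem_ofPred_eq, Set.mem_singleton_iff]
      at hi hj
    rcases lt_trichotomy i j with hlt | heq | hlt
    · exact (key i j hlt hj.1 hi.2 hj.2 hij).elim
    · exact heq
    · exact (key j i hlt hi.1 hj.2 hi.2 hij.symm).elim

end Singleton

/-! ### Weakly acyclic sets: tokens and ranks -/

section WeaklyAcyclic

/-- The composition of the renamings `ρ i, …, ρ (j - 1)`. -/
def drift (ρ : ℕ → Val C N → Val C N) (i : ℕ) : ℕ → Val C N → Val C N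
  | 0 => id
  | j + 1 => if i ≤ j then ρ j ∘ drift ρ i j else id

theorem drift_self (ρ : ℕ → Val C N → Val C N) (i : ℕ) : drift ρ i i = id := by
  cases i <;> simp [drift]

theorem drift_succ (ρ : ℕ → Val C N → Val C N) {i j : ℕ} (h : i ≤ j) :
    drift ρ i (j + 1) = ρ j ∘ drift ρ i j := by
  simp [drift, h]

theorem drift_comp (ρ : ℕ → Val C N → Val C N) {i j k : ℕ} (hij : i ≤ j) (hjk : j ≤ k)
    (v : Val C N) : drift ρ i k v = drift ρ j k (drift ρ i j v) := by
  induction k, hjk using Nat.le_induction with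
  | base => rw [drift_self]; rfl
  | succ k hjk ih =>
    rw [drift_succ ρ (hij.trans hjk), drift_succ ρ hjk, Function.comp_apply, ih]
    rfl

/-- `StepData` for the first `m` members of a sequence. -/
def StepsData (α : ℕ → Constraint ar C V) (σ : ℕ → V → Val C N) (s : ℕ → Set (Atom ar (Val C N)))
    (ρ : ℕ → Val C N → Val C N) (ν : ℕ → V → Val C N) (m : ℕ) : Prop :=
  ∀ j < m, StepData (α j) (σ j) (s j) (s (j + 1)) (ρ j) (ν j)

theorem Steps.exists_stepsData {α : ℕ → Constraint ar C V} {σ : ℕ → V → Val C N}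
    {s : ℕ → Set (Atom ar (Val C N))} {m : ℕ} (h : Steps α σ s m) :
    ∃ ρ ν, StepsData α σ s ρ ν m := by
  have : ∀ j, ∃ ρ ν, j < m → StepData (α j) (σ j) (s j) (s (j + 1)) ρ ν := by
    intro j
    by_cases hj : j < m
    · obtain ⟨ρ, ν, hd⟩ := exists_stepData (h j hj)
      exact ⟨ρ, ν, fun _ => hd⟩
    · exact ⟨id, σ j, fun h => (hj h).elim⟩
  choose ρ ν hd using this
  exact ⟨ρ, ν, hd⟩

section Trace

variable {α : ℕ → Constraint ar C V} {σ : ℕ → V → Val C N} {s : ℕ → Set (Atom ar (Val C N))}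
  {ρ : ℕ → Val C N → Val C N} {ν : ℕ → V → Val C N} {m : ℕ}

theorem StepsData.drift_const (h : StepsData α σ s ρ ν m) {i j : ℕ} (hj : j ≤ m) (c : C) :
    drift ρ i j (.const c) = .const c := by
  induction j with
  | zero => rfl
  | succ j ih =>
    by_cases hij : i ≤ j
    · rw [drift_succ ρ hij, Function.comp_apply, ih (by omega), (h j (by omega)).map_const]
    · simp [drift, hij]

theorem StepsData.drift_image_subset (h : StepsData α σ s ρ ν m) {i j : ℕ} (hij : i ≤ j)
    (hj : j ≤ m) : Atom.map (drift ρ i j) '' s i ⊆ s j := by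
  induction j, hij using Nat.le_induction with
  | base => rw [drift_self, map_id_image]
  | succ j hij ih =>
    rw [drift_succ ρ hij, ← map_map_image, (h j (by omega)).eq_union]
    exact (Set.image_mono (ih (by omega))).trans Set.subset_union_left

/-- The universally quantified variables in the head of `α` occur in the body of `α` in positions
of rank less than `p` only. -/
def FrontierBelow (rk : Position ar → ℕ) (p : ℕ) (α : Constraint ar C V) : Prop :=
  ∀ x ∈ vars (α.body : Set (Atom ar (Term C V))), x ∈ vars (α.head : Set (Atom ar (Term C V))) →
    ∀ π, OccursAt (α.body : Set (Atom ar (Term C V))) (.var x) π → rk π < p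

/-- Every element in a position of rank less than `p` descends from a member of `T`, a set of
elements with their times of birth. -/
def TokenCover (rk : Position ar → ℕ) (s : ℕ → Set (Atom ar (Val C N)))
    (ρ : ℕ → Val C N → Val C N) (m p : ℕ) (T : Set (ℕ × Val C N)) : Prop :=
  ∀ j ≤ m, ∀ π v, rk π < p → OccursAt (s j) v π → ∃ t ∈ T, t.1 ≤ j ∧ drift ρ t.1 j t.2 = v

theorem Constraint.eq_tgd_of_head_nonempty {γ : Constraint ar C V} (h : γ.head.Nonempty) :
    γ = .tgd γ.body γ.head h := by
  cases γ with
  | tgd body head hh => rfl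
  | egd body x y hne hx hy => simp [Constraint.head] at h

theorem exists_occursAt_of_mem_vars {X : Set (Atom ar (Term C V))} {x : V} (h : x ∈ vars X) :
    ∃ π, OccursAt X (.var x) π := by
  obtain ⟨A, hA, i, hi⟩ := h
  exact ⟨⟨A.rel, i⟩, A, hA, i, rfl, hi⟩

theorem mem_vars_of_occursAt {X : Set (Atom ar (Term C V))} {x : V} {π : Position ar}
    (h : OccursAt X (.var x) π) : x ∈ vars X := by
  obtain ⟨A, hA, i, -, hi⟩ := h
  exact ⟨A, hA, i, hi⟩

theorem occursAt_map {T T' : Type*} {f : T → T'} {X : Set (Atom ar T)} {v : T'} {π : Position ar} :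
    OccursAt (Atom.map f '' X) v π ↔ ∃ t, OccursAt X t π ∧ f t = v := by
  constructor
  · rintro ⟨_, ⟨A, hA, rfl⟩, i, hi, rfl⟩
    exact ⟨_, ⟨A, hA, i, hi, rfl⟩, rfl⟩
  · rintro ⟨_, ⟨A, hA, i, hi, rfl⟩, rfl⟩
    exact ⟨_, ⟨A, hA, rfl⟩, i, hi, rfl⟩

theorem OccursAt.mono {T : Type*} {X Y : Set (Atom ar T)} (h : X ⊆ Y) {t : T} {π : Position ar}
    (ht : OccursAt X t π) : OccursAt Y t π := by
  obtain ⟨A, hA, hi⟩ := ht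
  exact ⟨A, h hA, hi⟩

theorem OccursAt.mem_dom {T : Type*} {X : Set (Atom ar T)} {t : T} {π : Position ar}
    (h : OccursAt X t π) : t ∈ dom X := by
  obtain ⟨A, hA, i, -, hi⟩ := h
  exact ⟨A, hA, i, hi⟩

/-- An F-step copies a frontier value only from a position of no larger rank, where it already has a
token. If it invents a value at rank at most `p`, the special edges force its whole frontier below
`p`, so `hTf` provides the token. -/
theorem StepsData.tokenCover (h : StepsData α σ s ρ ν m) {F : Set (Constraint ar C V)}
    {rk : Position ar → ℕ} (hN : ∀ π₁ π₂, NormalEdge F π₁ π₂ → rk π₁ ≤ rk π₂)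
    (hS : ∀ π₁ π₂, SpecialEdge F π₁ π₂ → rk π₁ < rk π₂) {T : Set (ℕ × Val C N)} {p : ℕ}
    (hT0 : ∀ v ∈ dom (s 0), (0, v) ∈ T)
    (hTc : ∀ j < m, ∀ c, Term.const c ∈ dom ((α j).head : Set (Atom ar (Term C V))) →
      (0, Val.const c) ∈ T)
    (hTe : ∀ j < m, α j ∉ F → ∀ x ∈ vars ((α j).head : Set (Atom ar (Term C V))),
      (j + 1, ν j x) ∈ T)
    (hTf : ∀ j < m, α j ∈ F → FrontierBelow rk p (α j) →
      ∀ x ∈ vars ((α j).head : Set (Atom ar (Term C V))), (j + 1, ν j x) ∈ T) :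
    TokenCover rk s ρ m (p + 1) T := by
  intro j
  induction j with
  | zero => exact fun _ π v _ hv => ⟨(0, v), hT0 v hv.mem_dom, le_rfl, rfl⟩
  | succ j ih =>
    intro hj π v hπ hv
    have hd := h j (by omega)
    have ih := ih (by omega)
    rw [hd.eq_union] at hv
    obtain ⟨A, hA | hA, hi⟩ := hv
    · obtain ⟨u, hu, rfl⟩ := occursAt_map.1 (⟨A, hA, hi⟩ : OccursAt _ v π)
      obtain ⟨t, ht, htj, rfl⟩ := ih π u hπ hu
      exact ⟨t, ht, by omega, by rw [drift_succ ρ htj]; rfl⟩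
    · obtain ⟨c | x, hu, rfl⟩ := occursAt_map.1 (⟨A, hA, hi⟩ : OccursAt _ v π)
      · exact ⟨_, hTc j (by omega) c hu.mem_dom, by simp, h.drift_const hj c⟩
      · have hx := mem_vars_of_occursAt hu
        by_cases hF : α j ∈ F
        · have hne : (α j).head.Nonempty := by
            obtain ⟨B, hB, -⟩ := hu
            exact ⟨B, hB⟩
          rw [Constraint.eq_tgd_of_head_nonempty hne] at hF
          by_cases hxb : x ∈ vars ((α j).body : Set (Atom ar (Term C V)))
          · obtain ⟨π₁, hπ₁⟩ := exists_occursAt_of_mem_vars hxb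
            have hle := hN π₁ π ⟨_, _, _, hF, x, hπ₁, hu⟩
            obtain ⟨t, ht, htj, hte⟩ := ih π₁ (σ j x) (by omega)
              (OccursAt.mono hd.body_subset (occursAt_map.2 ⟨_, hπ₁, rfl⟩))
            refine ⟨t, ht, by omega, ?_⟩
            rw [drift_succ ρ htj, hd.eq_id hne, Function.comp_apply, hte]
            exact (hd.eqOn hxb).symm
          · refine ⟨_, hTf j (by omega) ?_ ?_ x hx, le_rfl, ?_⟩
            · rwa [Constraint.eq_tgd_of_head_nonempty hne]
            · intro x' hx'b hx'h π₁ hπ₁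
              have := hS π₁ π ⟨_, _, _, hF, x', x, hπ₁, hx'h, hxb, hu⟩
              omega
            · rw [drift_self]; rfl
        · exact ⟨_, hTe j (by omega) hF x hx, le_rfl, by rw [drift_self]; rfl⟩

/-- Two steps with the same TGD are triggered by different tokens. -/
theorem StepsData.ne_of_tokens (h : StepsData α σ s ρ ν m) {i j : ℕ} (hij : i < j) (hj : j < m)
    (hα : α i = α j) (hne : (α j).head.Nonempty) {t t' : V → ℕ × Val C N}
    (ht : ∀ x ∈ vars ((α i).body : Set (Atom ar (Term C V))),
      x ∈ vars ((α i).head : Set (Atom ar (Term C V))) →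
        (t x).1 ≤ i ∧ drift ρ (t x).1 i (t x).2 = σ i x)
    (ht' : ∀ x ∈ vars ((α j).body : Set (Atom ar (Term C V))),
      x ∈ vars ((α j).head : Set (Atom ar (Term C V))) →
        drift ρ (t' x).1 j (t' x).2 = σ j x) :
    ∃ x ∈ vars ((α j).body : Set (Atom ar (Term C V))),
      x ∈ vars ((α j).head : Set (Atom ar (Term C V))) ∧ t x ≠ t' x := by
  classical
  by_contra! hc
  have hi := h i (by omega)
  have hj' := h j hj
  rw [hα] at ht hi
  -- Extend the later trigger by the existential values of step `i`, carried forward to time `j`.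
  -- Equal tokens make this agree on the head with the carried `ν i`, whose image already lies in `s
  -- j`.
  refine hj'.not_head hne ⟨fun x => if x ∈ vars ((α j).body : Set (Atom ar (Term C V))) then σ j x
    else drift ρ (i + 1) j (ν i x), fun x hx => if_pos hx, ?_⟩
  have : image (fun x => if x ∈ vars ((α j).body : Set (Atom ar (Term C V))) then σ j x
      else drift ρ (i + 1) j (ν i x)) ((α j).head : Set (Atom ar (Term C V))) =
      image (drift ρ (i + 1) j ∘ ν i) ((α j).head : Set (Atom ar (Term C V))) := by
    apply image_congr
    intro x hx
    by_cases hxb : x ∈ vars ((α j).body : Set (Atom ar (Term C V)))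
    · simp only [hxb, if_true, Function.comp_apply]
      obtain ⟨h1, h2⟩ := ht x hxb hx
      rw [← ht' x hxb hx, ← hc x hxb hx, drift_comp ρ h1 hij.le, h2,
        drift_comp ρ (Nat.le_succ i) hij, drift_succ ρ le_rfl, drift_self, hi.eq_id hne,
        hi.eqOn hxb]
      rfl
    · simp [hxb]
  rw [this, ← map_image fun c => h.drift_const hj.le c]
  refine (Set.image_mono ?_).trans (h.drift_image_subset hij hj.le)
  rw [hi.eq_union]
  exact Set.subset_union_right

open Classical in
/-- The number of TGD steps with constraints of `F` that are triggered by elements descending from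
`T` only. -/
theorem StepsData.card_filter_le [Nonempty C] (h : StepsData α σ s ρ ν m)
    {F : Finset (Constraint ar C V)} {W : Finset V} {Z : Finset C}
    (hW : CoversSymbols (F : Set (Constraint ar C V)) W Z) {rk : Position ar → ℕ} {p : ℕ}
    {T : Finset (ℕ × Val C N)} (hT : TokenCover rk s ρ m p T) :
    ((Finset.range m).filter fun j => α j ∈ F ∧ (α j).head.Nonempty ∧
      FrontierBelow rk p (α j)).card ≤ F.card * (T.card + 1) ^ W.card := by
  obtain ⟨c₀⟩ := ‹Nonempty C›
  set G := (Finset.range m).filter fun j => α j ∈ F ∧ (α j).head.Nonempty ∧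
    FrontierBelow rk p (α j) with hG
  have htok : ∀ j x, ∃ t : ℕ × Val C N, j ∈ G → x ∈ vars ((α j).body : Set (Atom ar (Term C V))) →
      x ∈ vars ((α j).head : Set (Atom ar (Term C V))) →
        t ∈ T ∧ t.1 ≤ j ∧ drift ρ t.1 j t.2 = σ j x := by
    intro j x
    by_cases hx : j ∈ G ∧ x ∈ vars ((α j).body : Set (Atom ar (Term C V))) ∧
      x ∈ vars ((α j).head : Set (Atom ar (Term C V)))
    · obtain ⟨hj, hxb, hxh⟩ := hx
      obtain ⟨hjm, hjF, hjne, hjf⟩ : j < m ∧ _ := by simpa [hG] using hj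
      obtain ⟨π, hπ⟩ := exists_occursAt_of_mem_vars hxb
      obtain ⟨t, ht, h1, h2⟩ := hT j hjm.le π (σ j x) (hjf x hxb hxh π hπ)
        (OccursAt.mono (h j hjm).body_subset (occursAt_map.2 ⟨_, hπ, rfl⟩))
      exact ⟨t, fun _ _ _ => ⟨ht, h1, h2⟩⟩
    · exact ⟨(0, .const c₀), fun h1 h2 h3 => (hx ⟨h1, h2, h3⟩).elim⟩
  choose t ht using htok
  set d : ℕ × Val C N := (0, .const c₀)
  -- A step is coded by its TGD and its frontier tokens; all other variables get the default `d`.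
  set f : ℕ → Constraint ar C V × (W → ℕ × Val C N) := fun j => (α j, fun x =>
    if (x : V) ∈ vars ((α j).body : Set (Atom ar (Term C V))) ∧
      (x : V) ∈ vars ((α j).head : Set (Atom ar (Term C V))) then t j x else d) with hf
  have hcard : (F ×ˢ Fintype.piFinset fun _ : W => insert d T).card ≤
      F.card * (T.card + 1) ^ W.card := by
    rw [Finset.card_product, Fintype.card_piFinset, Finset.prod_const,
      Finset.card_univ, Fintype.card_coe]
    gcongr
    exact Finset.card_insert_le _ _
  refine le_trans (Finset.card_le_card_of_injOn f ?_ ?_) hcard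
  · intro j hj
    rw [Finset.mem_coe] at hj
    obtain ⟨hjm, hjF, hjne, hjf⟩ : j < m ∧ _ := by simpa [hG] using hj
    rw [Finset.mem_coe, Finset.mem_product, Fintype.mem_piFinset]
    refine ⟨hjF, fun x => ?_⟩
    simp only [hf]
    split_ifs with hx
    · exact Finset.mem_insert_of_mem (ht j x hj hx.1 hx.2).1
    · exact Finset.mem_insert_self _ _
  · have key : ∀ i j, i < j → i ∈ G → j ∈ G → f i ≠ f j := by
      intro i j hij hi hj hfij
      obtain ⟨hjm, hjF, hjne, hjf⟩ : j < m ∧ _ := by simpa [hG] using hj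
      simp only [hf, Prod.mk.injEq] at hfij
      obtain ⟨hα, hv⟩ := hfij
      obtain ⟨x, hxb, hxh, hne⟩ := h.ne_of_tokens hij hjm hα hjne
        (fun x h1 h2 => (ht i x hi h1 h2).2) fun x h1 h2 => (ht j x hj h1 h2).2.2
      have := congrFun hv ⟨x, (hW _ hjF).1 hxb⟩
      rw [hα] at this
      exact hne (by simpa [hxb, hxh] using this)
    intro i hi j hj hij
    rcases lt_trichotomy i j with hlt | heq | hlt
    · exact (key i j hlt hi hj hij).elim
    · exact heq
    · exact (key j i hlt hj hi hij.symm).elim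

/-- A bound on the number of tokens that are needed for the positions of rank less than `p`. -/
def tokenBound (b f w : ℕ) : ℕ → ℕ
  | 0 => b
  | p + 1 => b + f * (tokenBound b f w p + 1) ^ w * w

/-- Tokens for ranks below `p` bound the F-steps with frontier below `p`, and only these can invent
values at rank `p`. The initial tokens are the domain, the head constants and the values from steps
outside `F`. -/
theorem StepsData.exists_tokenCover [Nonempty C] (h : StepsData α σ s ρ ν m) (h0 : (s 0).Finite)
    {S : Set (Constraint ar C V)} {F : Finset (Constraint ar C V)} (hFS : ↑F ⊆ S)
    {W : Finset V} {Z : Finset C} (hW : CoversSymbols S W Z) (hα : ∀ j < m, α j ∈ S)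
    {rk : Position ar → ℕ}
    (hN : ∀ π₁ π₂, NormalEdge (F : Set (Constraint ar C V)) π₁ π₂ → rk π₁ ≤ rk π₂)
    (hS : ∀ π₁ π₂, SpecialEdge (F : Set (Constraint ar C V)) π₁ π₂ → rk π₁ < rk π₂) (p : ℕ) :
    ∃ T : Finset (ℕ × Val C N), TokenCover rk s ρ m p T ∧ T.card ≤ tokenBound
      ((dom (s 0)).ncard + Z.card + stepCount α (F : Set (Constraint ar C V))ᶜ m * W.card)
      F.card W.card p := by
  classical
  induction p with
  | zero =>
    exact ⟨∅, fun _ _ _ _ hπ => absurd hπ (Nat.not_lt_zero _), Nat.zero_le _⟩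
  | succ p ih =>
    obtain ⟨T, hT, hTc⟩ := ih
    have hG := h.card_filter_le (hW.mono hFS) hT
    set G := (Finset.range m).filter fun j => α j ∈ F ∧ (α j).head.Nonempty ∧
      FrontierBelow rk p (α j) with hGdef
    set E := (Finset.range m).filter fun j => α j ∈ (F : Set (Constraint ar C V))ᶜ with hE
    have hEc : E.card = stepCount α (F : Set (Constraint ar C V))ᶜ m := by
      unfold stepCount
      congr 1
      ext j
      simp [hE]
    set new : Finset ℕ → Finset (ℕ × Val C N) :=
      fun X => X.biUnion fun j => W.image fun x => (j + 1, ν j x)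
    have hnewc : ∀ X, (new X).card ≤ X.card * W.card := fun X =>
      Finset.card_biUnion_le_card_mul _ _ _ fun j _ => Finset.card_image_le
    have hmem : ∀ X j, j ∈ X → j < m → ∀ x ∈ vars ((α j).head : Set (Atom ar (Term C V))),
        (j + 1, ν j x) ∈ new X := by
      intro X j hj hjm x hx
      exact Finset.mem_biUnion.2 ⟨j, hj, Finset.mem_image.2 ⟨x, (hW _ (hα j hjm)).2.1 hx, rfl⟩⟩
    refine ⟨(finite_dom h0).toFinset.image (fun v => (0, v)) ∪
      Z.image (fun c => (0, Val.const c)) ∪ new E ∪ new G, h.tokenCover hN hS ?_ ?_ ?_ ?_, ?_⟩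
    · intro v hv
      simp [hv]
    · intro j hj c hc
      simp [(hW _ (hα j hj)).2.2 c hc]
    · intro j hj hF x hx
      have := hmem E j (by simpa [hE, hj] using hF) hj x hx
      simp only [Finset.coe_union, Set.mem_union, Finset.mem_coe]
      exact Or.inl (Or.inr this)
    · intro j hj hF hf x hx
      have hne : (α j).head.Nonempty := by
        obtain ⟨A, hA, -⟩ := hx
        exact ⟨A, hA⟩
      have := hmem G j (by
        simp only [hGdef, Finset.mem_filter, Finset.mem_range]
        exact ⟨hj, hF, hne, hf⟩) hj x hx
      simp only [Finset.coe_union, Set.mem_union, Finset.mem_coe]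
      exact Or.inr this
    · refine (Finset.card_union_le _ _).trans (add_le_add ((Finset.card_union_le _ _).trans
        (add_le_add ((Finset.card_union_le _ _).trans (add_le_add ?_ Finset.card_image_le)) ?_)) ?_)
      · rw [Set.ncard_eq_toFinset_card _ (finite_dom h0)]
        exact Finset.card_image_le
      · rw [← hEc]
        exact hnewc E
      · refine (hnewc G).trans (Nat.mul_le_mul_right _ (hG.trans ?_))
        gcongr

end Trace

/-- The length of a chase sequence in terms of the number of steps with constraints outside of `F`,
if the dependency graph of `F` can be ranked. -/
theorem length_le_of_rank [Nonempty C] {α : ℕ → Constraint ar C V} {σ : ℕ → V → Val C N}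
    {s : ℕ → Set (Atom ar (Val C N))} {m : ℕ} (h0 : (s 0).Finite) (h : Steps α σ s m)
    {S : Set (Constraint ar C V)} {F : Finset (Constraint ar C V)} (hFS : ↑F ⊆ S)
    {W : Finset V} {Z : Finset C} (hW : CoversSymbols S W Z) (hα : ∀ j < m, α j ∈ S)
    {rk : Position ar → ℕ}
    (hN : ∀ π₁ π₂, NormalEdge (F : Set (Constraint ar C V)) π₁ π₂ → rk π₁ ≤ rk π₂)
    (hS : ∀ π₁ π₂, SpecialEdge (F : Set (Constraint ar C V)) π₁ π₂ → rk π₁ < rk π₂)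
    {r : ℕ} (hr : ∀ π, rk π < r) :
    m ≤ (dom (s 0)).ncard + (W.card + Z.card + 1) *
      (stepCount α (F : Set (Constraint ar C V))ᶜ m + F.card * (tokenBound
        ((dom (s 0)).ncard + Z.card + stepCount α (F : Set (Constraint ar C V))ᶜ m * W.card)
        F.card W.card r + 1) ^ W.card) := by
  classical
  obtain ⟨ρ, ν, hd⟩ := h.exists_stepsData
  obtain ⟨T, hT, hTc⟩ := hd.exists_tokenCover h0 hFS hW hα hN hS r
  have hG := (hd.card_filter_le (hW.mono hFS) hT).trans
    (Nat.mul_le_mul_left _ (Nat.pow_le_pow_left (Nat.succ_le_succ hTc) _))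
  set k := stepCount α (F : Set (Constraint ar C V))ᶜ m
  set g := F.card * (tokenBound ((dom (s 0)).ncard + Z.card + k * W.card)
    F.card W.card r + 1) ^ W.card
  -- Since `r` exceeds all ranks, every frontier lies below `r`, and the filter catches all TGD
  -- steps of `F`.
  have h1 : stepCount α ({γ | γ.head.Nonempty} ∩ F) m ≤ g := by
    refine le_trans ?_ hG
    unfold stepCount
    refine Finset.card_le_card fun j hj => ?_
    simp only [Finset.mem_filter, Finset.mem_range] at hj ⊢
    exact ⟨hj.1, hj.2.2, hj.2.1, fun x _ _ π _ => hr π⟩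
  have h2 : stepCount α {γ | γ.head.Nonempty} m ≤ k + g := by
    refine (stepCount_le_add α (D₁ := (F : Set (Constraint ar C V))ᶜ)
      (D₂ := {γ | γ.head.Nonempty} ∩ F) (fun γ hγ => ?_) m).trans (Nat.add_le_add_left h1 _)
    by_cases hF : γ ∈ (F : Set (Constraint ar C V))
    · exact Or.inr ⟨hγ, hF⟩
    · exact Or.inl hF
  have h3 := stepCount_add_ncard_dom_le hW h0 h hα
  have h4 := stepCount_add_compl α {γ | γ.head.Nonempty} m
  have h5 := Nat.mul_le_mul_left (W.card + Z.card) h2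
  rw [add_mul, one_mul]
  omega

end WeaklyAcyclic

/-! ### Ranks and cycles in the two graphs -/

section Graph

theorem WeaklyAcyclic.exists_rank [Finite R] {F : Set (Constraint ar C V)} (h : WeaklyAcyclic F) :
    ∃ rk : Position ar → ℕ, (∀ π₁ π₂, NormalEdge F π₁ π₂ → rk π₁ ≤ rk π₂) ∧
      (∀ π₁ π₂, SpecialEdge F π₁ π₂ → rk π₁ < rk π₂) ∧ ∃ r, ∀ π, rk π < r := by
  set E : Position ar → Position ar → Prop := fun p q => NormalEdge F p q ∨ SpecialEdge F p q
  -- The rank of a position is the number of special edges whose target reaches it. A special edge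
  -- counts at its own target, but not at its source unless it lies on a cycle.
  set X : Position ar → Set (Position ar × Position ar) := fun π =>
    {e | SpecialEdge F e.1 e.2 ∧ Relation.ReflTransGen E e.2 π}
  have hsub : ∀ p q, E p q → X p ⊆ X q := fun p q hpq e he => ⟨he.1, he.2.tail hpq⟩
  refine ⟨fun π => (X π).ncard, fun p q hpq => ?_, fun p q hpq => ?_,
    (Set.univ : Set (Position ar × Position ar)).ncard + 1, fun π => ?_⟩
  · exact Set.ncard_le_ncard (hsub p q (Or.inl hpq)) (Set.toFinite _)
  · refine Set.ncard_lt_ncard ((hsub p q (Or.inr hpq)).ssubset_of_ne fun heq => ?_)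
      (Set.toFinite _)
    have hmem : (p, q) ∈ X q := ⟨hpq, Relation.ReflTransGen.refl⟩
    rw [← heq] at hmem
    exact h ⟨p, q, hpq, hmem.2⟩
  · exact Nat.lt_succ_of_le (Set.ncard_le_ncard (Set.subset_univ _) (Set.toFinite _))

theorem WeaklyAcyclic.mono {F F' : Set (Constraint ar C V)} (h : WeaklyAcyclic F') (hF : F ⊆ F') :
    WeaklyAcyclic F := by
  rintro ⟨p, q, ⟨b, hd, hh, hm, hs⟩, hqp⟩
  refine h ⟨p, q, ⟨b, hd, hh, hF hm, hs⟩, Relation.ReflTransGen.mono ?_ _ _ hqp⟩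
  rintro p q (⟨b, hd, hh, hm, hs⟩ | ⟨b, hd, hh, hm, hs⟩)
  · exact Or.inl ⟨b, hd, hh, hF hm, hs⟩
  · exact Or.inr ⟨b, hd, hh, hF hm, hs⟩

/-- `w 0, …, w k` is a walk from `a` to `b`. -/
def IsWalk {X : Type*} (r : X → X → Prop) (a b : X) (k : ℕ) (w : ℕ → X) : Prop :=
  w 0 = a ∧ w k = b ∧ ∀ i < k, r (w i) (w (i + 1))

theorem IsWalk.append {X : Type*} {r : X → X → Prop} {a b c : X} {k l : ℕ} {w w' : ℕ → X}
    (h : IsWalk r a b k w) (h' : IsWalk r b c l w') :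
    ∃ u, IsWalk r a c (k + l) u ∧ (∀ i ≤ k, u i = w i) ∧ ∀ i ≤ l, u (k + i) = w' i := by
  have h1 : ∀ i ≤ k, (if i ≤ k then w i else w' (i - k)) = w i := fun i hi => if_pos hi
  have h2 : ∀ i, (if k + i ≤ k then w (k + i) else w' (k + i - k)) = w' i := by
    intro i
    rcases Nat.eq_zero_or_pos i with rfl | hi
    · simp [h.2.1, h'.1]
    · rw [if_neg (by omega), Nat.add_sub_cancel_left]
  refine ⟨fun i => if i ≤ k then w i else w' (i - k), ⟨?_, ?_, fun i hi => ?_⟩, h1, fun i _ => h2 i⟩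
  · exact (h1 0 (Nat.zero_le _)).trans h.1
  · exact (h2 l).trans h'.2.1
  · by_cases hik : i < k
    · simp only [h1 i hik.le, h1 (i + 1) hik]
      exact h.2.2 i hik
    · obtain ⟨j, rfl⟩ := Nat.exists_eq_add_of_le (not_lt.1 hik)
      have := h'.2.2 j (by omega)
      rw [← h2 j, ← h2 (j + 1)] at this
      exact this

theorem exists_isWalk {X : Type*} {r : X → X → Prop} {a b : X} (h : Relation.ReflTransGen r a b) :
    ∃ k w, IsWalk r a b k w := by
  induction h with
  | refl => exact ⟨0, fun _ => a, rfl, rfl, fun i hi => absurd hi (Nat.not_lt_zero _)⟩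
  | @tail b c _ hbc ih =>
    obtain ⟨k, w, hw⟩ := ih
    have : IsWalk r b c 1 (fun i => if i = 0 then b else c) :=
      ⟨rfl, rfl, fun i hi => by simpa [Nat.lt_one_iff.1 hi] using hbc⟩
    obtain ⟨u, hu, -⟩ := hw.append this
    exact ⟨_, u, hu⟩

/-- Detours from `β` to each member of `F` and back are appended to one loop. The final vertex
repeats the first, so the indices up to `k` suffice. -/
theorem exists_closed_walk {X : Type*} {r : X → X → Prop} {β : X} (hβ : Relation.TransGen r β β)
    (F : Finset X) (hF : ∀ γ ∈ F, Relation.ReflTransGen r β γ ∧ Relation.ReflTransGen r γ β) :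
    ∃ k w, IsWalk r β β (k + 1) w ∧ ∀ γ ∈ F, ∃ i ≤ k, w i = γ := by
  classical
  suffices ∃ k w, IsWalk r β β (k + 1) w ∧ ∀ γ ∈ F, ∃ i ≤ k + 1, w i = γ by
    obtain ⟨k, w, hw, hv⟩ := this
    refine ⟨k, w, hw, fun γ hγ => ?_⟩
    obtain ⟨i, hi, rfl⟩ := hv γ hγ
    rcases hi.eq_or_lt with rfl | hi
    · exact ⟨0, Nat.zero_le _, hw.1.trans hw.2.1.symm⟩
    · exact ⟨i, Nat.lt_succ_iff.1 hi, rfl⟩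
  induction F using Finset.induction_on with
  | empty =>
    obtain ⟨c, hc, hcβ⟩ := Relation.TransGen.head'_iff.1 hβ
    obtain ⟨k, w, hw⟩ := exists_isWalk hcβ
    have : IsWalk r β c 1 (fun i => if i = 0 then β else c) :=
      ⟨rfl, rfl, fun i hi => by simpa [Nat.lt_one_iff.1 hi] using hc⟩
    obtain ⟨u, hu, -⟩ := this.append hw
    exact ⟨k, u, by rwa [add_comm], by simp⟩
  | insert γ F _ ih =>
    obtain ⟨k, w, hw, hv⟩ := ih fun δ hδ => hF δ (Finset.mem_insert_of_mem hδ)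
    obtain ⟨h1, h2⟩ := hF γ (Finset.mem_insert_self _ _)
    obtain ⟨k₁, w₁, hw₁⟩ := exists_isWalk h1
    obtain ⟨k₂, w₂, hw₂⟩ := exists_isWalk h2
    obtain ⟨u, hu, hu1, -⟩ := hw.append hw₁
    obtain ⟨u', hu', hu'1, -⟩ := hu.append hw₂
    refine ⟨k + k₁ + k₂, u', by convert hu' using 1; omega, fun δ hδ => ?_⟩
    rcases Finset.mem_insert.1 hδ with rfl | hδ
    · exact ⟨k + 1 + k₁, by omega, (hu'1 _ le_rfl).trans hu.2.1⟩
    · obtain ⟨i, hi, rfl⟩ := hv δ hδ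
      exact ⟨i, by omega, (hu'1 i (by omega)).trans (hu1 i hi)⟩

/-- The edges of the c-chase graph of `S`. -/
def ChaseEdge (N : Type*) (S : Set (Constraint ar C V)) (γ δ : Constraint ar C V) : Prop :=
  γ ∈ S ∧ δ ∈ S ∧ PrecC N γ δ

theorem CStratified.mono {S S' : Set (Constraint ar C V)} (h : CStratified N S) (hS : S' ⊆ S) :
    CStratified N S' :=
  fun k c hc => h k c fun i => ⟨hS (hc i).1, (hc i).2⟩

theorem CStratified.weaklyAcyclic_of_loop {S : Set (Constraint ar C V)} (h : CStratified N S)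
    {β : Constraint ar C V} (hβ : Relation.TransGen (ChaseEdge N S) β β)
    (F : Finset (Constraint ar C V))
    (hF : ∀ γ ∈ F, Relation.ReflTransGen (ChaseEdge N S) β γ ∧
      Relation.ReflTransGen (ChaseEdge N S) γ β) :
    WeaklyAcyclic (F : Set (Constraint ar C V)) := by
  obtain ⟨k, w, hw, hv⟩ := exists_closed_walk hβ F hF
  refine (h k (fun i => w i) fun i => ?_).mono fun γ hγ => ?_
  · have hi := hw.2.2 i i.2
    refine ⟨hi.1, ?_⟩
    -- At the last index the addition in `Fin (k + 1)` wraps to 0, where the walk has the same value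
    -- `β`.
    have hnext : w ((i + 1 : Fin (k + 1)) : ℕ) = w (i + 1) := by
      rcases (Nat.lt_succ_iff.1 i.2).eq_or_lt with heq | hlt
      · have : i = Fin.last k := Fin.ext heq
        rw [this, Fin.last_add_one, Fin.val_zero, Fin.val_last, hw.1, hw.2.1]
      · rw [Fin.val_add_one_of_lt (Fin.lt_def.2 hlt)]
    simp only [hnext]
    exact hi.2.2
  · obtain ⟨i, hi, rfl⟩ := hv γ hγ
    exact ⟨⟨i, Nat.lt_succ_of_le hi⟩, rfl⟩

/-- A finite nonempty directed graph has a strongly connected component without outgoing edges. -/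
theorem exists_sink {X : Type*} {S : Set X} (hfin : S.Finite) (hne : S.Nonempty)
    (r : X → X → Prop) : ∃ β ∈ S, ∀ γ ∈ S, Relation.ReflTransGen r β γ →
      Relation.ReflTransGen r γ β := by
  set reach : X → Set X := fun β => {γ ∈ S | Relation.ReflTransGen r β γ}
  obtain ⟨β, hβ, hmin⟩ := Set.exists_min_image S (fun β => (reach β).ncard) hfin hne
  refine ⟨β, hβ, fun γ hγ hβγ => ?_⟩
  have hsub : reach γ ⊆ reach β := fun δ hδ => ⟨hδ.1, hβγ.trans hδ.2⟩
  have heq := Set.eq_of_subset_of_ncard_le hsub (hmin γ hγ) (hfin.subset fun _ h => h.1)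
  have : β ∈ reach γ := by
    rw [heq]
    exact ⟨hβ, Relation.ReflTransGen.refl⟩
  exact this.2

end Graph

/-! ### Induction over the components -/

section Main

theorem tokenBound_mono {b b' : ℕ} (h : b ≤ b') (f w p : ℕ) :
    tokenBound b f w p ≤ tokenBound b' f w p := by
  induction p with
  | zero => exact h
  | succ p ih =>
    unfold tokenBound
    gcongr

/-- The depth `p` of the iteration depends on the constraints only, so the bound stays polynomial.
-/
theorem exists_eval_eq_tokenBound (B : Polynomial ℕ) (f w p : ℕ) :
    ∃ T : Polynomial ℕ, ∀ n, T.eval n = tokenBound (B.eval n) f w p := by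
  induction p with
  | zero => exact ⟨B, fun _ => rfl⟩
  | succ p ih =>
    obtain ⟨T, hT⟩ := ih
    refine ⟨B + Polynomial.C f * (T + 1) ^ w * Polynomial.C w, fun n => ?_⟩
    simp [tokenBound, hT]

theorem stepCount_le_of_imp {α : ℕ → Constraint ar C V} {D D' : Set (Constraint ar C V)} {m : ℕ}
    (h : ∀ j < m, α j ∈ D → α j ∈ D') : stepCount α D m ≤ stepCount α D' m := by
  unfold stepCount
  refine Finset.card_le_card fun j hj => ?_
  simp only [Finset.mem_filter, Finset.mem_range] at hj ⊢
  exact ⟨hj.1, h j hj.1 hj.2⟩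

/-- There is a polynomial bound on the length of the chase sequences with constraints from `S`. -/
def HasPolyBound (N : Type*) (S : Set (Constraint ar C V)) : Prop :=
  ∃ Q : Polynomial ℕ, ∀ I : Set (Atom ar (Val C N)), I.Finite →
    ChaseBound S I (Q.eval (dom I).ncard)

theorem HasPolyBound.of_weaklyAcyclic [Finite R] [Nonempty C] [Infinite N]
    {S D : Set (Constraint ar C V)} (hfin : S.Finite) (hD : HasPolyBound N D)
    (hED : ∀ γ ∈ S \ D, ∀ δ ∈ D, ¬ PrecC N γ δ) (hw : WeaklyAcyclic (S \ D)) :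
    HasPolyBound N S := by
  obtain ⟨Q, hQ⟩ := hD
  obtain ⟨W, Z, hW⟩ := exists_coversSymbols hfin
  obtain ⟨rk, hN, hS, r, hr⟩ := hw.exists_rank
  have hF : ((hfin.sdiff (t := D)).toFinset : Set (Constraint ar C V)) = S \ D :=
    Set.Finite.coe_toFinset _
  set F := (hfin.sdiff (t := D)).toFinset
  rw [← hF] at hN hS
  obtain ⟨T, hT⟩ := exists_eval_eq_tokenBound
    (Polynomial.X + Polynomial.C Z.card + Q * Polynomial.C W.card) F.card W.card r
  refine ⟨Polynomial.X + Polynomial.C (W.card + Z.card + 1) *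
    (Q + Polynomial.C F.card * (T + 1) ^ W.card), fun I hI α σ s m hs hα h => ?_⟩
  subst hs
  obtain ⟨s', σ', hs0, h', hr', -⟩ := exists_noReuse hI h
  obtain ⟨K, hK0, -, hK⟩ := exists_subchase hED (by rwa [hs0]) h' hr'
    fun j hj hjD => ⟨hα j hj, hjD⟩
  have hq := (hQ (s 0) hI).stepCount_le (hK0.trans hs0) hK
  have hq' : stepCount α (F : Set (Constraint ar C V))ᶜ m ≤ Q.eval (dom (s 0)).ncard := by
    refine (stepCount_le_of_imp fun j hj hjF => ?_).trans hq
    by_contra hjD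
    exact hjF (hF ▸ ⟨hα j hj, hjD⟩)
  -- Renaming keeps the constraints used, so the D-count carries over to the original sequence; the
  -- token argument needs no fresh nulls.
  refine (length_le_of_rank hI h (hF.trans_subset Set.sdiff_subset) hW hα hN hS hr).trans ?_
  simp only [Polynomial.eval_add, Polynomial.eval_mul, Polynomial.eval_X, Polynomial.eval_C,
    Polynomial.eval_pow, Polynomial.eval_one, hT]
  gcongr
  exact tokenBound_mono (by gcongr) _ _ _

theorem HasPolyBound.of_singleton [Nonempty C] [Infinite N]
    {S D : Set (Constraint ar C V)} (hfin : S.Finite) (hD : HasPolyBound N D)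
    {β : Constraint ar C V} (hβ : S \ D ⊆ {β}) (hββ : ¬ PrecC N β β)
    (hED : ∀ δ ∈ D, ¬ PrecC N β δ) : HasPolyBound N S := by
  obtain ⟨Q, hQ⟩ := hD
  obtain ⟨W, Z, hW⟩ := exists_coversSymbols hfin
  refine ⟨Q + (Q + 1) * (Polynomial.X + Polynomial.C (W.card + Z.card) * Q + 1) ^ W.card,
    fun I hI α σ s m hs hα h => ?_⟩
  subst hs
  obtain ⟨s', σ', hs0, h', hr', -⟩ := exists_noReuse hI h
  have hD' : ∀ j < m, α j ∉ D → α j = β := fun j hj hjD => hβ ⟨hα j hj, hjD⟩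
  obtain ⟨K, hK0, hKp, hK⟩ := exists_subchase (E := {β}) (by rintro γ rfl; exact hED)
    (by rwa [hs0]) h' hr' hD'
  have hq := (hQ (s 0) hI).stepCount_le (hK0.trans hs0) hK
  have h1 := stepCount_singleton_le hW hββ (by rwa [hs0]) h' hα hD' hK0 hKp hK
  have h2 := stepCount_add_compl α D m
  have h3 : stepCount α Dᶜ m ≤ stepCount α {β} m := stepCount_le_of_imp hD'
  rw [hs0] at h1
  simp only [Polynomial.eval_add, Polynomial.eval_mul, Polynomial.eval_X, Polynomial.eval_C,
    Polynomial.eval_pow, Polynomial.eval_one]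
  rw [← h2]
  refine add_le_add hq (h3.trans (h1.trans ?_))
  gcongr

theorem CStratified.hasPolyBound [Finite R] [Nonempty C] [Infinite N]
    {S : Set (Constraint ar C V)} (hfin : S.Finite) (hS : CStratified N S) : HasPolyBound N S := by
  induction hn : S.ncard using Nat.strong_induction_on generalizing S with
  | _ n ih =>
  subst hn
  rcases S.eq_empty_or_nonempty with rfl | hne
  · refine ⟨0, fun I _ α σ s m _ hα _ => ?_⟩
    by_contra hm
    exact hα 0 (by omega)
  obtain ⟨β, hβS, hβ⟩ := exists_sink hfin hne (ChaseEdge N S)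
  -- By the choice of `β`, everything in `S` reachable from it reaches it back, so `S \ D` is
  -- exactly its component.
  set D : Set (Constraint ar C V) :=
    {γ ∈ S | ¬ Relation.ReflTransGen (ChaseEdge N S) β γ}
  have hDS : D ⊆ S := fun _ h => h.1
  have hβD : β ∉ D := fun h => h.2 Relation.ReflTransGen.refl
  have hSD : ∀ γ ∈ S \ D, Relation.ReflTransGen (ChaseEdge N S) β γ := by
    intro γ hγ
    by_contra hc
    exact hγ.2 ⟨hγ.1, hc⟩
  have hED : ∀ γ ∈ S \ D, ∀ δ ∈ D, ¬ PrecC N γ δ :=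
    fun γ hγ δ hδ hγδ => hδ.2 ((hSD γ hγ).tail ⟨hγ.1, hδ.1, hγδ⟩)
  have hD : HasPolyBound N D := by
    refine ih _ ?_ (hfin.subset hDS) (hS.mono hDS) rfl
    exact Set.ncard_lt_ncard (hDS.ssubset_of_ne fun h => hβD (h ▸ hβS)) hfin
  by_cases hloop : Relation.TransGen (ChaseEdge N S) β β
  · refine hD.of_weaklyAcyclic hfin hED ?_
    rw [← Set.Finite.coe_toFinset (hfin.sdiff (t := D))]
    refine hS.weaklyAcyclic_of_loop hloop _ fun γ hγ => ?_
    rw [Set.Finite.mem_toFinset] at hγ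
    exact ⟨hSD γ hγ, hβ γ hγ.1 (hSD γ hγ)⟩
  -- Without a loop at `β` the component is `β` alone: another member would give a closed walk
  -- through `β`.
  · refine hD.of_singleton (β := β) hfin (fun γ hγ => ?_) (fun h => hloop (.single ⟨hβS, hβS, h⟩))
      (hED β ⟨hβS, hβD⟩)
    by_contra hne
    have h1 := hSD γ hγ
    rcases Relation.reflTransGen_iff_eq_or_transGen.1 h1 with h2 | h2
    · exact hne h2
    · exact hloop (h2.trans_left (hβ γ hγ.1 h1))

end Main

end Chase

theorem mainTheorem3 {R : Type*} [Finite R] (ar : R → ℕ)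
    {C N V : Type*} [Infinite C] [Infinite N] [Infinite V]
    (S : Set (Chase.Constraint ar C V)) (hfin : S.Finite) (hS : Chase.CStratified N S) :
    ∃ Q : Polynomial ℕ, ∀ I : Set (Chase.Atom ar (Chase.Val C N)), I.Finite →
      ∀ (len : ℕ∞) (s : ℕ → Set (Chase.Atom ar (Chase.Val C N))),
        Chase.IsChaseSequence S I len s →
          len ≤ ((Q.eval (Chase.dom I).ncard : ℕ) : ℕ∞) := by
  obtain ⟨Q, hQ⟩ := hS.hasPolyBound hfin
  refine ⟨Q, fun I hI len s hs => ?_⟩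
  by_contra hlen
  rw [not_le] at hlen
  -- A sequence that is too long, possibly infinite, is cut after one step more than the bound; `α₀`
  -- and a constant assignment only fill the indices beyond.
  obtain ⟨α₀, -⟩ := hs.2 0 (lt_of_le_of_lt (by simp) hlen)
  have hstep : ∀ j, ∃ (α : Chase.Constraint ar C V) (σ : V → Chase.Val C N),
      j < Q.eval (Chase.dom I).ncard + 1 → α ∈ S ∧ Chase.Step α σ (s j) (s (j + 1)) := by
    intro j
    by_cases hj : j < Q.eval (Chase.dom I).ncard + 1
    · obtain ⟨α, hα, σ, h⟩ := hs.2 j (lt_of_le_of_lt (by exact_mod_cast Nat.lt_succ_iff.1 hj) hlen)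
      exact ⟨α, σ, fun _ => ⟨hα, h⟩⟩
    · obtain ⟨c⟩ : Nonempty C := inferInstance
      exact ⟨α₀, fun _ => .const c, fun h => (hj h).elim⟩
  choose α σ h using hstep
  have := hQ I hI α σ s _ hs.1 (fun j hj => (h j hj).1) fun j hj => (h j hj).2
  omega
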